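/- **Theorem (discrete energy estimate).** Let $\Omega\subset\mathbb R^2$ be a bounded open polygonal domain with $\Omega=\mathrm{int}\,\overline\Omega$, and let $\Omega_h$ be a conforming mesh of $\overline\Omega$ by finitely many polygons which is regular with parameter $\rho>0$: every cell $P$, of diameter $h_P$, is star-shaped with respect to a disk of radius $\rho h_P$, and each edge of $P$ has length at least $\rho h_P$. *Spaces.* For scalar $v$ let $\mathbf{rot}\,v=(\partial_y v,-\partial_x v)$, and for plane vectors let $a\times b=a_1b_2-a_2b_1$. $\mathcal V_h$ is the space of continuous $v$ on $\overline\Omega$ that are in each cell $P$ harmonic with $\nabla v\in L^2(P)$, and affine on each edge; $\mathcal V_{h,0}=\{v\in\mathcal V_h: v|_{\partial\Omega}=0\}$. $\mathcal E_h$ is the space of $w\in H(\mathrm{div};\Omega)$ such that in each cell $\mathrm{div}\,w$ is constant, $\mathrm{rot}\,w=0$, and $w\cdot n$ is constant on each edge. $\mathcal I^{\mathcal V_h}$ is nodal (vertex) interpolation, and $\Pi^{RT}$ is the cellwise $L^2$-orthogonal projection onto $\{a+bx: a\in\mathbb R^2,\ b\in\mathbb R\}$; $\mathcal I^{\mathcal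 V_h}(u\times\Pi^{RT}B)$ is formed cell by cell. *Inner products.* On $\mathcal V_h$ and $\mathcal E_h$ let $$[v,w]_{\mathcal V_h}=\sum_P\Big(\int_P \Pi_Pv\,\Pi_Pw+S_P^{\mathcal V}(v-\Pi_Pv,\,w-\Pi_Pw)\Big),\qquad [v,w]_{\mathcal E_h}=\sum_P\Big(\int_P\Pi^{RT}v\cdot\Pi^{RT}w+S_P^{\mathcal E}(v-\Pi^{RT}v,\,w-\Pi^{RT}w)\Big),$$ where $\Pi_P$ is a linear projection of the local nodal space onto the affine functions with $\|\Pi_Pv\|_{L^2(P)}\le c_\Pi\|v\|_{L^2(P)}$, and $S_P^{\mathcal V},S_P^{\mathcal E}$ are symmetric positive semidefinite bilinear forms with $s_0\|v\|_{L^2(P)}^2\le S_P(v,v)\le s_1\|v\|^2_{L^2(P)}$ for the $v$ in the local space whose projection is zero ($0<s_0\le s_1$). Write $|||\cdot|||_{\mathcal V_h}$, $|||\cdot|||_{\mathcal E_h}$ for the corresponding norms and $|||v|||^2_{H(\mathrm{rot})}=|||v|||^2_{\mathcal V_h}+|||\mathbf{rot}\,v|||^2_{\mathcal E_h}$. *Scheme.*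 Let $u$ be a continuous vector field on $\overline\Omega$, $\|u\|_\infty=\sup_{\overline\Omega}|u|$, $\theta\in[0,1]$, $\Delta t>0$, and let $E_0^{n+\theta}$ be given functions on $\overline\Omega$. A discrete solution consists of $B^0,\dots,B^N\in\mathcal E_h$ and $\widehat E^{\theta},\dots,\widehat E^{N-1+\theta}\in\mathcal V_{h,0}$ such that, for $0\le n<N$, with $B^{n+\theta}=\theta B^{n+1}+(1-\theta)B^n$, and for all $w\in\mathcal E_h$, $v\in\mathcal V_{h,0}$, $$\Big[\frac{B^{n+1}-B^n}{\Delta t},w\Big]_{\mathcal E_h}+[\mathbf{rot}\,\widehat E^{n+\theta},w]_{\mathcal E_h}+[\mathbf{rot}\,\mathcal I^{\mathcal V_h}E_0^{n+\theta},w]_{\mathcal E_h}=0,$$ $$[\widehat E^{n+\theta},v]_{\mathcal V_h}+[\mathcal I^{\mathcal V_h}E_0^{n+\theta},v]_{\mathcal V_h}+[\mathcal I^{\mathcal V_h}(u\times\Pi^{RT}B^{n+\theta}),v]_{\mathcal V_h}-[B^{n+\theta},\mathbf{rot}\,v]_{\mathcal E_h}=0.$$ *Claim.* There is a constant $\widetilde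 C>0$ depending only on $\rho,c_\Pi,s_0,s_1$ (in particular not on $\Omega$, the mesh, $\Delta t$, $\theta$, $u$ or the data) such that $$\big|[\mathcal I^{\mathcal V_h}(u\times\Pi^{RT}B),v]_{\mathcal V_h}\big|\le\widetilde C\,\|u\|_\infty\|B\|_{L^2(\Omega)}\|v\|_{L^2(\Omega)}\qquad(B\in\mathcal E_h,\ v\in\mathcal V_h)$$ and every discrete solution satisfies the following. (i) For $\theta\in[0,1]$ and $0\le n<N$, $$\Big(\theta-\frac12\Big)\frac{|||B^{n+1}-B^n|||_{\mathcal E_h}^2}{\Delta t}+\frac{|||B^{n+1}|||_{\mathcal E_h}^2-|||B^n|||_{\mathcal E_h}^2}{2\Delta t}+\frac12|||\widehat E^{n+\theta}|||_{\mathcal V_h}^2\le|||\mathcal I^{\mathcal V_h}E_0^{n+\theta}|||^2_{H(\mathrm{rot})}+\frac12\big(1+4\widetilde C\|u\|_\infty^2\big)\Big(\theta|||B^{n+1}|||_{\mathcal E_h}^2+(1-\theta)|||B^n|||_{\mathcal E_h}^2\Big).$$ (ii) Let $\theta\in[\frac12,1]$ and $\Delta t<\dfrac1{\theta(1+4\widetilde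 C\|u\|_\infty^2)}$, and put $$Q=\Delta t(1+4\widetilde C\|u\|_\infty^2),\qquad\beta=\frac{1-Q\theta}{1+Q(1-\theta)},\qquad\gamma=\frac1{1-Q\theta}.$$ Then $\beta>0$, $\gamma>0$, and for $0\le n<N$, $$\beta^{n+1}|||B^{n+1}|||_{\mathcal E_h}^2+\frac{\gamma\Delta t}2\sum_{\ell=0}^n\beta^{n+1-\ell}|||\widehat E^{n-\ell+\theta}|||_{\mathcal V_h}^2\le|||B^0|||_{\mathcal E_h}^2+\gamma\Delta t\sum_{\ell=0}^n\beta^{n+1-\ell}|||\mathcal I^{\mathcal V_h}E_0^{n-\ell+\theta}|||^2_{H(\mathrm{rot})}.$$ -/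

import Mathlib

open MeasureTheory
open scoped ContDiff RealInnerProductSpace

noncomputable section

namespace VEM

/-- The Euclidean plane. -/
abbrev Plane := EuclideanSpace ℝ (Fin 2)

/-- The scalar cross product `a × b = a₁ b₂ - a₂ b₁` of two plane vectors. -/
def cross (a b : Plane) : ℝ := a 0 * b 1 - a 1 * b 0

/-- The vector-valued rotor `rot v = (∂v/∂y, -∂v/∂x)` of a scalar function. -/
def rot (v : Plane → ℝ) (x : Plane) : Plane :=
  !₂[fderiv ℝ v x (EuclideanSpace.single 1 1), -fderiv ℝ v x (EuclideanSpace.single 0 1)]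

/-! ### Polygons and meshes -/

/-- A closed polygonal region bounded by a simple closed polygonal line with `k + 3` vertices.
Indices are cyclic (addition in `Fin (k + 3)`); straight angles are allowed. -/
structure Polygon where
  k : ℕ
  vertex : Fin (k + 3) → Plane
  vertex_injective : Function.Injective vertex
  simple : ∀ i j, i ≠ j →
    segment ℝ (vertex i) (vertex (i + 1)) ∩ segment ℝ (vertex j) (vertex (j + 1)) ⊆
      {vertex i, vertex (i + 1)} ∩ {vertex j, vertex (j + 1)}
  carrier : Set Plane
  isCompact_carrier : IsCompact carrier
  closure_interior_carrier : closure (interior carrier) = carrier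
  frontier_carrier : frontier carrier = ⋃ i, segment ℝ (vertex i) (vertex (i + 1))

namespace Polygon

variable (P : Polygon)

/-- The `i`-th edge. -/
def edge (i : Fin (P.k + 3)) : Set Plane := segment ℝ (P.vertex i) (P.vertex (i + 1))

/-- The diameter `h_P`. -/
def diam : ℝ := Metric.diam P.carrier

/-- Line integral (with respect to arc length) over the `i`-th edge. -/
def edgeIntegral (i : Fin (P.k + 3)) (φ : Plane → ℝ) : ℝ :=
  dist (P.vertex i) (P.vertex (i + 1)) *
    ∫ t in (0 : ℝ)..1, φ (AffineMap.lineMap (P.vertex i) (P.vertex (i + 1)) t)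

end Polygon

/-- A conforming polygonal mesh of the closure of `Ω`: finitely many polygons with disjoint
interiors; two edges of distinct polygons coincide or meet at most in common end points. -/
structure Mesh (Ω : Set Plane) where
  numCells : ℕ
  cell : Fin numCells → Polygon
  iUnion_cell : ⋃ c, (cell c).carrier = closure Ω
  disjoint_interior : ∀ c c', c ≠ c' →
    Disjoint (interior (cell c).carrier) (interior (cell c').carrier)
  conforming : ∀ c c', c ≠ c' → ∀ i j,
    (cell c).edge i = (cell c').edge j ∨
      (cell c).edge i ∩ (cell c').edge j ⊆
        {(cell c).vertex i, (cell c).vertex (i + 1)} ∩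
          {(cell c').vertex j, (cell c').vertex (j + 1)}

/-- Mesh regularity with parameter `ρ`: every cell is star-shaped with respect to all the points
of a disk of radius `ρ h_P`, and its edges are not shorter than `ρ h_P`. -/
def Mesh.IsRegular {Ω : Set Plane} (M : Mesh Ω) (ρ : ℝ) : Prop :=
  ∀ c, (∃ z, ∀ y ∈ Metric.ball z (ρ * (M.cell c).diam), StarConvex ℝ y (M.cell c).carrier) ∧
    ∀ i, ρ * (M.cell c).diam ≤ dist ((M.cell c).vertex i) ((M.cell c).vertex (i + 1))

/-! ### The nodal space -/

/-- Polynomials of degree at most one. -/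
def IsAffineFun (q : Plane → ℝ) : Prop := ∃ (a : ℝ) (b : Plane), ∀ x, q x = a + ⟪b, x⟫

/-- The local nodal virtual element space: `v` is continuous on the closed cell, affine on each
edge, harmonic inside (`rot rot v = 0`), and has square integrable first derivatives.
Only the values on the cell matter. -/
structure IsLocalNodal (P : Polygon) (v : Plane → ℝ) : Prop where
  continuousOn : ContinuousOn v P.carrier
  affine_edge : ∀ i, ∀ t ∈ Set.Icc (0 : ℝ) 1,
    v (AffineMap.lineMap (P.vertex i) (P.vertex (i + 1)) t) =
      (1 - t) * v (P.vertex i) + t * v (P.vertex (i + 1))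
  harmonic : InnerProductSpace.HarmonicOnNhd v (interior P.carrier)
  memLp_rot : MemLp (rot v) 2 (volume.restrict P.carrier)

/-- The global nodal space `𝒱_h`. Being single valued and continuous on each of the finitely many
closed cells, its members are continuous on the closure of `Ω`, hence conforming. -/
def IsNodal {Ω : Set Plane} (M : Mesh Ω) (v : Plane → ℝ) : Prop :=
  ∀ c, IsLocalNodal (M.cell c) v

/-- The subspace `𝒱_{h,0}` of the nodal functions that vanish on the boundary of `Ω`. -/
def IsNodalZero {Ω : Set Plane} (M : Mesh Ω) (v : Plane → ℝ) : Prop :=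
  IsNodal M v ∧ ∀ x ∈ frontier Ω, v x = 0

open Classical in
/-- Nodal interpolation in one cell: the local nodal function with the vertex values of `f`. -/
def localInterp (P : Polygon) (f : Plane → ℝ) : Plane → ℝ :=
  if h : ∃ v, IsLocalNodal P v ∧ ∀ i, v (P.vertex i) = f (P.vertex i) then h.choose else 0

open Classical in
/-- Global nodal interpolation `ℐ^{𝒱_h} f`: the function in `𝒱_h` with the vertex values of `f`. -/
def interp {Ω : Set Plane} (M : Mesh Ω) (f : Plane → ℝ) : Plane → ℝ :=
  if h : ∃ v, IsNodal M v ∧ ∀ c i, v ((M.cell c).vertex i) = f ((M.cell c).vertex i)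
  then h.choose else 0

/-! ### The edge space -/

/-- The lowest-order Raviart-Thomas fields `x ↦ a + b x`. -/
def IsRT (q : Plane → Plane) : Prop := ∃ (a : Plane) (b : ℝ), ∀ x, q x = a + b • x

/-- The local edge virtual element space: square integrable fields with constant divergence `d`,
constant outward normal component `g i` on the `i`-th edge (both expressed by Green's formula),
and zero weak rotor. -/
structure IsLocalEdge (P : Polygon) (w : Plane → Plane) : Prop where
  memLp : MemLp w 2 (volume.restrict P.carrier)
  div_normal : ∃ (d : ℝ) (g : Fin (P.k + 3) → ℝ), ∀ φ : Plane → ℝ, ContDiff ℝ ∞ φ →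
    ∫ x in P.carrier, ⟪w x, gradient φ x⟫ =
      -(d * ∫ x in P.carrier, φ x) + ∑ i, g i * P.edgeIntegral i φ
  rot_free : ∀ φ : Plane → ℝ, ContDiff ℝ ∞ φ → HasCompactSupport φ →
    tsupport φ ⊆ interior P.carrier → ∫ x in P.carrier, ⟪w x, rot φ x⟫ = 0

/-- The global edge space `ℰ_h`: cellwise local edge fields that belong to `H(div; Ω)`. -/
structure IsEdge {Ω : Set Plane} (M : Mesh Ω) (w : Plane → Plane) : Prop where
  loc : ∀ c, IsLocalEdge (M.cell c) w
  hdiv : ∃ d : Plane → ℝ, MemLp d 2 (volume.restrict Ω) ∧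
    ∀ φ : Plane → ℝ, ContDiff ℝ ∞ φ → HasCompactSupport φ → tsupport φ ⊆ Ω →
      ∫ x in Ω, ⟪w x, gradient φ x⟫ = -∫ x in Ω, d x * φ x

open Classical in
/-- The `L²(P)`-orthogonal projection `Π^{RT}` onto the Raviart-Thomas fields. -/
def rtProj (P : Polygon) (w : Plane → Plane) : Plane → Plane :=
  if h : ∃ q, IsRT q ∧ ∀ p, IsRT p → ∫ x in P.carrier, ⟪w x - q x, p x⟫ = 0
  then h.choose else 0

/-! ### Virtual element inner products -/

/-- The free choices in the virtual element inner products, for each cell: the projection of the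
nodal functions onto the affine ones, and the two stabilization forms. They are written as maps on
all functions; only their action on the local virtual element spaces matters. -/
structure Forms {Ω : Set Plane} (M : Mesh Ω) where
  nodalProj : Fin M.numCells → ((Plane → ℝ) →ₗ[ℝ] (Plane → ℝ))
  nodalStab : Fin M.numCells → LinearMap.BilinForm ℝ (Plane → ℝ)
  edgeStab : Fin M.numCells → LinearMap.BilinForm ℝ (Plane → Plane)

/-- The standard requirements on these choices: the nodal projection maps onto the affine
functions, reproduces them, and is bounded by `cP` in `L²(P)`; the stabilization forms are symmetric
and positive semidefinite, and on the kernel of the respective projection they are equivalent to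
the square of the `L²(P)` norm, with constants `s₀` and `s₁`. (A projection or a semidefinite form
given on a subspace always extends to all functions, so nothing is lost by the larger domain.) -/
structure Forms.IsAdmissible {Ω : Set Plane} {M : Mesh Ω} (F : Forms M) (cP s₀ s₁ : ℝ) :
    Prop where
  proj_affine : ∀ c v, IsLocalNodal (M.cell c) v → IsAffineFun (F.nodalProj c v)
  proj_eq : ∀ c q, IsAffineFun q → F.nodalProj c q = q
  proj_bound : ∀ c v, IsLocalNodal (M.cell c) v →
    ∫ x in (M.cell c).carrier, F.nodalProj c v x ^ 2 ≤
      cP ^ 2 * ∫ x in (M.cell c).carrier, v x ^ 2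
  nodal_symm : ∀ c v w, F.nodalStab c v w = F.nodalStab c w v
  nodal_nonneg : ∀ c v, 0 ≤ F.nodalStab c v v
  nodal_lower : ∀ c v, IsLocalNodal (M.cell c) v → F.nodalProj c v = 0 →
    s₀ * ∫ x in (M.cell c).carrier, v x ^ 2 ≤ F.nodalStab c v v
  nodal_upper : ∀ c v, IsLocalNodal (M.cell c) v → F.nodalProj c v = 0 →
    F.nodalStab c v v ≤ s₁ * ∫ x in (M.cell c).carrier, v x ^ 2
  edge_symm : ∀ c v w, F.edgeStab c v w = F.edgeStab c w v
  edge_nonneg : ∀ c w, 0 ≤ F.edgeStab c w w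
  edge_lower : ∀ c w, IsLocalEdge (M.cell c) w → rtProj (M.cell c) w = 0 →
    s₀ * ∫ x in (M.cell c).carrier, ‖w x‖ ^ 2 ≤ F.edgeStab c w w
  edge_upper : ∀ c w, IsLocalEdge (M.cell c) w → rtProj (M.cell c) w = 0 →
    F.edgeStab c w w ≤ s₁ * ∫ x in (M.cell c).carrier, ‖w x‖ ^ 2

namespace Forms

variable {Ω : Set Plane} {M : Mesh Ω} (F : Forms M)

/-- The local nodal inner product: projected part plus stabilization. -/
def localNodal (c : Fin M.numCells) (v w : Plane → ℝ) : ℝ :=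
  (∫ x in (M.cell c).carrier, F.nodalProj c v x * F.nodalProj c w x) +
    F.nodalStab c (v - F.nodalProj c v) (w - F.nodalProj c w)

/-- The local edge inner product: projected part plus stabilization. -/
def localEdge (c : Fin M.numCells) (v w : Plane → Plane) : ℝ :=
  (∫ x in (M.cell c).carrier, ⟪rtProj (M.cell c) v x, rtProj (M.cell c) w x⟫) +
    F.edgeStab c (v - rtProj (M.cell c) v) (w - rtProj (M.cell c) w)

/-- The inner product on `𝒱_h`. -/
def nodal (v w : Plane → ℝ) : ℝ := ∑ c, F.localNodal c v w

/-- The inner product on `ℰ_h`. -/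
def edge (v w : Plane → Plane) : ℝ := ∑ c, F.localEdge c v w

/-- The squared norm on `𝒱_h`. -/
def nodalSq (v : Plane → ℝ) : ℝ := F.nodal v v

/-- The squared norm on `ℰ_h`. -/
def edgeSq (w : Plane → Plane) : ℝ := F.edge w w

/-- The squared discrete `H(rot)` norm. -/
def hrotSq (v : Plane → ℝ) : ℝ := F.nodalSq v + F.edgeSq (rot v)

/-- The `𝒱_h` product of `ℐ^{𝒱_h}(u × Π^{RT} B)` with `v`. The field `Π^{RT} B` is defined cell by
cell and jumps across edges, so projection and interpolation are performed in each cell. -/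
def convection (u B : Plane → Plane) (v : Plane → ℝ) : ℝ :=
  ∑ c, F.localNodal c
    (localInterp (M.cell c) fun x => cross (u x) (rtProj (M.cell c) B x)) v

end Forms

/-- The supremum norm over the closure of `Ω`. -/
def supNorm (Ω : Set Plane) (u : Plane → Plane) : ℝ := ⨆ x : closure Ω, ‖u x‖

/-- The `θ`-average `B^{n+θ} = θ B^{n+1} + (1 - θ) B^n`. -/
def thetaAvg (θ : ℝ) (B : ℕ → Plane → Plane) (n : ℕ) : Plane → Plane :=
  θ • B (n + 1) + (1 - θ) • B n

/-- The sequences `B n` (the magnetic field at time `n Δt`) and `E n` (the part with zero boundary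
values of the electric field at time `(n + θ) Δt`) solve the first `N` steps of the virtual element
scheme with velocity `u` and boundary lifting `E₀ n` at time `(n + θ) Δt`. The initial field `B 0`
may be any member of `ℰ_h`. -/
structure IsSolution {Ω : Set Plane} {M : Mesh Ω} (F : Forms M) (u : Plane → Plane)
    (θ dt : ℝ) (N : ℕ) (E₀ : ℕ → Plane → ℝ) (B : ℕ → Plane → Plane) (E : ℕ → Plane → ℝ) :
    Prop where
  mem_edge : ∀ n ≤ N, IsEdge M (B n)
  mem_nodal : ∀ n < N, IsNodalZero M (E n)
  faraday : ∀ n < N, ∀ w, IsEdge M w →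
    F.edge (dt⁻¹ • (B (n + 1) - B n)) w + F.edge (rot (E n)) w
      + F.edge (rot (interp M (E₀ n))) w = 0
  ampereOhm : ∀ n < N, ∀ v, IsNodalZero M v →
    F.nodal (E n) v + F.nodal (interp M (E₀ n)) v + F.convection u (thetaAvg θ B n) v
      - F.edge (thetaAvg θ B n) (rot v) = 0

end VEM

end

open MeasureTheory
open scoped ContDiff RealInnerProductSpace

noncomputable section

namespace VEM

/-! The energy balance is algebra. Faraday's law is tested with B^{n+θ}, the Ampère-Ohm law with
E^{n+θ}; on addition the two coupling terms cancel by symmetry of the edge form. Since [B^{n+1} -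
B^n, B^{n+θ}] = (θ - 1/2)|||B^{n+1} - B^n|||² + (|||B^{n+1}|||² - |||B^n|||²)/2, what remains to be
bounded are two data terms and the convection term. Cauchy-Schwarz, Young and the convexity bound
|||B^{n+θ}|||² ≤ θ|||B^{n+1}|||² + (1-θ)|||B^n|||² do this in `IsSolution.energy_step`. One Young
weight is left free: weight 1 gives (i), while weight 1/2 halves the data term and leaves a quarter
of |||E|||². The second version is what `theta_gronwall` turns into (ii); the data term of (i) is
twice too large for that.

The analysis lies in the convection bound, proved cell by cell in `localConvection_sq_le`. By the
maximum principle a local nodal function is bounded by its vertex values, so the L² norm of the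
interpolant is at most |P|^{1/2} times the largest |u × Π^{RT}B| at a vertex. The inverse estimate
`IsRT.volume_mul_norm_sq_le` bounds |P| |Π^{RT}B|² at a point by the L² norm of Π^{RT}B, because the
cell contains a disk of comparable size. Finally Π^{RT} is an L² contraction, and a discrete
Cauchy-Schwarz inequality sums the cells.

The discrete norms must also dominate the L² norms. For edge fields the stabilization bound applies
to w - Π^{RT}w only if this is again a local edge field, so Raviart-Thomas fields must be shown to
satisfy Green's formula on a star-shaped polygon. This is done by cutting the polygon into triangles
with apex in the disk (`Polygon.green_radial`). -/

/-! ### Null boundaries, and splitting integrals over Ω into cells -/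

theorem volume_line_eq_zero (a b : Plane) :
    volume ((affineSpan ℝ {a, b} : AffineSubspace ℝ Plane) : Set Plane) = 0 := by
  refine Measure.addHaar_affineSubspace volume _ fun h => ?_
  have h1 : Module.finrank ℝ (vectorSpan ℝ ({a, b} : Set Plane)) = 2 := by
    rw [← direction_affineSpan, h, AffineSubspace.direction_top, finrank_top]
    simp
  have h2 : Module.finrank ℝ (vectorSpan ℝ ({a, b} : Set Plane)) ≤ 1 := by
    rw [vectorSpan_pair_rev]
    exact (finrank_span_le_card _).trans (by simp)
  omega

theorem volume_segment_eq_zero (a b : Plane) : volume (segment ℝ a b) = 0 :=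
  measure_mono_null (by
    rw [← convexHull_pair]
    exact convexHull_subset_affineSpan _) (volume_line_eq_zero a b)

namespace Polygon

variable (P : Polygon)

theorem isClosed_carrier : IsClosed P.carrier := P.isCompact_carrier.isClosed

theorem measurableSet_carrier : MeasurableSet P.carrier := P.isClosed_carrier.measurableSet

theorem edge_subset_frontier (i : Fin (P.k + 3)) : P.edge i ⊆ frontier P.carrier := by
  rw [P.frontier_carrier]
  exact Set.subset_iUnion (fun i => segment ℝ (P.vertex i) (P.vertex (i + 1))) i

theorem edge_subset_carrier (i : Fin (P.k + 3)) : P.edge i ⊆ P.carrier :=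
  (P.edge_subset_frontier i).trans P.isClosed_carrier.frontier_subset

theorem vertex_mem_carrier (i : Fin (P.k + 3)) : P.vertex i ∈ P.carrier :=
  P.edge_subset_carrier i (left_mem_segment ℝ _ _)

theorem diam_pos : 0 < P.diam := by
  have h : dist (P.vertex 0) (P.vertex 1) ≤ P.diam :=
    Metric.dist_le_diam_of_mem P.isCompact_carrier.isBounded (P.vertex_mem_carrier 0)
      (P.vertex_mem_carrier 1)
  have h01 : P.vertex 0 ≠ P.vertex 1 := fun h => by
    have := P.vertex_injective h
    simp at this
  exact (dist_pos.2 h01).trans_le h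

theorem volume_frontier : volume (frontier P.carrier) = 0 := by
  rw [P.frontier_carrier]
  exact measure_iUnion_null fun i => volume_segment_eq_zero _ _

theorem interior_ae_eq_carrier : interior P.carrier =ᵐ[volume] P.carrier :=
  interior_ae_eq_of_null_frontier P.volume_frontier

theorem volume_carrier_lt_top : volume P.carrier < ⊤ := P.isCompact_carrier.measure_lt_top

instance : IsFiniteMeasure (volume.restrict P.carrier) :=
  ⟨by simpa using P.volume_carrier_lt_top⟩

theorem ball_subset_carrier {z : Plane} {r : ℝ}
    (h : ∀ y ∈ Metric.ball z r, StarConvex ℝ y P.carrier) : Metric.ball z r ⊆ P.carrier :=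
  fun y hy => (h y hy).mem ⟨_, P.vertex_mem_carrier 0⟩

theorem carrier_subset_closedBall {z : Plane} (hz : z ∈ P.carrier) :
    P.carrier ⊆ Metric.closedBall z P.diam := fun _ hx =>
  Metric.dist_le_diam_of_mem P.isCompact_carrier.isBounded hx hz

end Polygon

namespace Mesh

variable {Ω : Set Plane} (M : Mesh Ω)

theorem isCompact_closure {Ω : Set Plane} (M : Mesh Ω) : IsCompact (closure Ω) := by
  rw [← M.iUnion_cell]
  exact isCompact_iUnion fun c => (M.cell c).isCompact_carrier

theorem carrier_subset_closure (c : Fin M.numCells) : (M.cell c).carrier ⊆ closure Ω := by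
  rw [← M.iUnion_cell]
  exact Set.subset_iUnion (fun c => (M.cell c).carrier) c

theorem interior_subset (hΩ : interior (closure Ω) = Ω) (c : Fin M.numCells) :
    interior (M.cell c).carrier ⊆ Ω :=
  (interior_mono (M.carrier_subset_closure c)).trans hΩ.le

/-- The cells cover the closure of Ω, and their interiors lie in int(closure Ω) = Ω; the two unions
differ only by cell boundaries, which are null. So ∂Ω never has to be described. -/
theorem ae_eq_iUnion (hΩ : interior (closure Ω) = Ω) :
    Ω =ᵐ[volume] ⋃ c, (M.cell c).carrier := by
  have h1 : Ω ⊆ ⋃ c, (M.cell c).carrier := by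
    rw [M.iUnion_cell]
    exact subset_closure
  refine (LE.le.eventuallyLE h1).antisymm ?_
  have h2 : (⋃ c, interior (M.cell c).carrier) ≤ᵐ[volume] Ω :=
    LE.le.eventuallyLE (Set.iUnion_subset fun c => M.interior_subset hΩ c)
  exact (Filter.EventuallyEq.countable_iUnion fun c =>
    (M.cell c).interior_ae_eq_carrier).symm.le.trans h2

theorem pairwise_aedisjoint :
    Pairwise (Function.onFun (AEDisjoint volume) fun c => (M.cell c).carrier) := fun c c' h =>
  (M.disjoint_interior c c' h).aedisjoint.congr (M.cell c).interior_ae_eq_carrier.symm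
    (M.cell c').interior_ae_eq_carrier.symm

theorem integrableOn_of_cells (hΩ : interior (closure Ω) = Ω) {E : Type*} [NormedAddCommGroup E]
    {f : Plane → E} (hf : ∀ c, IntegrableOn f (M.cell c).carrier) : IntegrableOn f Ω :=
  (integrableOn_finite_iUnion.2 hf).congr_set_ae (M.ae_eq_iUnion hΩ)

theorem setIntegral_eq_sum (hΩ : interior (closure Ω) = Ω) {f : Plane → ℝ}
    (hf : ∀ c, IntegrableOn f (M.cell c).carrier) :
    ∫ x in Ω, f x = ∑ c, ∫ x in (M.cell c).carrier, f x := by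
  rw [setIntegral_congr_set (M.ae_eq_iUnion hΩ),
    integral_iUnion_ae (fun c => (M.cell c).measurableSet_carrier.nullMeasurableSet)
      M.pairwise_aedisjoint (integrableOn_finite_iUnion.2 hf), tsum_fintype]

theorem memLp_of_cells (hΩ : interior (closure Ω) = Ω) {w : Plane → Plane}
    (hw : ∀ c, MemLp w 2 (volume.restrict (M.cell c).carrier)) :
    MemLp w 2 (volume.restrict Ω) := by
  have hm : AEStronglyMeasurable w (volume.restrict Ω) := by
    rw [Measure.restrict_congr_set (M.ae_eq_iUnion hΩ)]
    exact (aestronglyMeasurable_iUnion_iff).2 fun c => (hw c).1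
  rw [memLp_two_iff_integrable_sq_norm hm]
  exact M.integrableOn_of_cells hΩ fun c => (hw c).integrable_norm_pow two_ne_zero

end Mesh

/-! ### Maximum principle for local nodal functions -/

theorem deriv_deriv_nonpos_of_isLocalMax {g : ℝ → ℝ} {a : ℝ} (h : IsLocalMax g a)
    (hc : ContinuousAt g a) : deriv (deriv g) a ≤ 0 := by
  by_contra! hpos
  -- A positive second derivative would make the maximum also a local minimum, hence the function
  -- locally constant, with second derivative zero.
  have hmin := isLocalMin_of_deriv_deriv_pos hpos h.deriv_eq_zero hc
  have hconst : g =ᶠ[nhds a] fun _ => g a := by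
    filter_upwards [h, hmin] with x h1 h2 using le_antisymm h1 h2
  have h0 : deriv (deriv g) a = 0 := by
    rw [hconst.deriv.deriv_eq]
    simp
  linarith

theorem deriv_deriv_comp_line {E : Type*} [NormedAddCommGroup E] [NormedSpace ℝ E] {f : E → ℝ}
    {x : E} (hf : ContDiffAt ℝ 2 f x) (e : E) :
    deriv (deriv fun t : ℝ => f (x + t • e)) 0 = fderiv ℝ (fderiv ℝ f) x e e := by
  have hl : ∀ t : ℝ, HasDerivAt (fun t : ℝ => x + t • e) e t := fun t => by
    simpa using ((hasDerivAt_id t).smul_const e).const_add x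
  have hl0 : Filter.Tendsto (fun t : ℝ => x + t • e) (nhds 0) (nhds x) := by
    simpa using (hl 0).continuousAt.tendsto
  have hd : ∀ᶠ t in nhds (0 : ℝ), deriv (fun t : ℝ => f (x + t • e)) t
      = fderiv ℝ f (x + t • e) e := by
    have h1 : ∀ᶠ y in nhds x, DifferentiableAt ℝ f y := by
      filter_upwards [hf.eventually (by simp)] with y hy using hy.differentiableAt (by simp)
    filter_upwards [hl0.eventually h1] with t ht
    exact (ht.hasFDerivAt.comp_hasDerivAt t (hl t)).deriv
  rw [Filter.EventuallyEq.deriv_eq hd]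
  have h3 : DifferentiableAt ℝ (fderiv ℝ f) (x + (0 : ℝ) • e) := by
    simpa using (hf.fderiv_right (m := 1) (by norm_num)).differentiableAt (by simp)
  have h4 := (h3.hasFDerivAt.comp_hasDerivAt 0 (hl 0))
  have h5 := ((ContinuousLinearMap.apply ℝ ℝ e).hasFDerivAt (x := _)).comp_hasDerivAt 0 h4
  simpa [Function.comp_def] using h5.deriv

open InnerProductSpace Laplacian in
theorem laplacian_nonpos_of_isLocalMax {f : Plane → ℝ} {x : Plane} (h : IsLocalMax f x)
    (hf : ContDiffAt ℝ 2 f x) : Δ f x ≤ 0 := by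
  rw [laplacian_eq_iteratedFDeriv_orthonormalBasis f (EuclideanSpace.basisFun (Fin 2) ℝ)]
  refine Finset.sum_nonpos fun i _ => ?_
  set e := (EuclideanSpace.basisFun (Fin 2) ℝ) i
  rw [iteratedFDeriv_two_apply]
  simp only [Matrix.cons_val_zero, Matrix.cons_val_one]
  rw [← deriv_deriv_comp_line hf e]
  have hl : ContinuousAt (fun t : ℝ => x + t • e) 0 := by fun_prop
  have hl0 : Filter.Tendsto (fun t : ℝ => x + t • e) (nhds 0) (nhds x) := by
    simpa using hl.tendsto
  refine deriv_deriv_nonpos_of_isLocalMax ?_ ?_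
  · have := hl0.eventually h
    simpa [IsLocalMax, IsMaxFilter] using this
  · refine ContinuousAt.comp (f := fun t : ℝ => x + t • e) ?_ hl
    simpa using hf.continuousAt

open InnerProductSpace Laplacian in
theorem laplacian_norm_sq (x : Plane) : Δ (fun y : Plane => ‖y‖ ^ 2) x = 4 := by
  rw [laplacian_eq_iteratedFDeriv_orthonormalBasis _ (EuclideanSpace.basisFun (Fin 2) ℝ)]
  have h : fderiv ℝ (fun y : Plane => ‖y‖ ^ 2) = fun y => 2 • innerSL ℝ y := by
    ext y v
    simp [fderiv_norm_sq_apply]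
  have h2 : ∀ y : Plane, fderiv ℝ (fun y : Plane => 2 • innerSL ℝ y) y = 2 • innerSL ℝ := by
    intro y
    exact ((2 • (innerSL ℝ : Plane →L[ℝ] Plane →L[ℝ] ℝ)).hasFDerivAt (x := y)).fderiv
  simp only [iteratedFDeriv_two_apply, h, h2]
  have h3 : ∀ i : Fin 2, (innerSL ℝ (EuclideanSpace.single i (1 : ℝ)) : Plane →L[ℝ] ℝ)
      (EuclideanSpace.single i 1) = 1 := fun i => by
    rw [innerSL_apply_apply]
    simp
  simp [h3]
  norm_num

open InnerProductSpace Laplacian in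
-- Adding ε‖y‖², whose Laplacian is 4ε > 0, excludes an interior maximum, so the perturbed function
-- peaks on the frontier. The perturbation is at most δ on K by the choice of ε, and δ is arbitrary.
theorem harmonic_le_of_frontier_le {K : Set Plane} (hK : IsCompact K) {v : Plane → ℝ}
    (hv : ContinuousOn v K) (hh : HarmonicOnNhd v (interior K)) {m : ℝ}
    (hm : ∀ x ∈ frontier K, v x ≤ m) : ∀ x ∈ K, v x ≤ m := by
  intro x hx
  obtain ⟨R, hR⟩ := hK.isBounded.exists_norm_le
  refine le_of_forall_pos_le_add fun δ hδ => ?_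
  set ε := δ / (R ^ 2 + 1) with hε
  have hεpos : 0 < ε := by positivity
  set w : Plane → ℝ := fun y => v y + ε * ‖y‖ ^ 2
  have hw : ContinuousOn w K := hv.add (by fun_prop)
  obtain ⟨y, hy, hmax⟩ := hK.exists_isMaxOn ⟨x, hx⟩ hw
  have hyR : ε * ‖y‖ ^ 2 ≤ δ := by
    have : ‖y‖ ^ 2 ≤ R ^ 2 := pow_le_pow_left₀ (norm_nonneg _) (hR y hy) 2
    calc ε * ‖y‖ ^ 2 ≤ ε * (R ^ 2 + 1) := by gcongr; linarith
      _ = δ := by rw [hε]; field_simp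
  have hfr : y ∈ frontier K := by
    rw [hK.isClosed.frontier_eq]
    refine ⟨hy, fun hyi => ?_⟩
    have hloc : IsLocalMax w y := hmax.isLocalMax (mem_interior_iff_mem_nhds.1 hyi)
    have h1 : ContDiffAt ℝ 2 v y := (hh y hyi).1
    have h2 : ContDiffAt ℝ 2 (fun z : Plane => ‖z‖ ^ 2) y := (contDiff_norm_sq ℝ).contDiffAt
    have h3 : ContDiffAt ℝ 2 (ε • fun z : Plane => ‖z‖ ^ 2) y := h2.const_smul ε
    have h4 := laplacian_nonpos_of_isLocalMax hloc (h1.add h3)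
    have h5 : Δ w y = Δ v y + ε • 4 := by
      rw [← laplacian_norm_sq y, ← laplacian_smul ε h2, ← h1.laplacian_add h3]
      rfl
    have h6 : Δ v y = 0 := (hh y hyi).2.self_of_nhds
    rw [h5, h6] at h4
    simp at h4
    linarith
  have h1 : w x ≤ w y := hmax hx
  have h2 := hm y hfr
  have h3 : 0 ≤ ε * ‖x‖ ^ 2 := by positivity
  simp only [w] at h1
  linarith

theorem IsLocalNodal.neg {P : Polygon} {v : Plane → ℝ} (hv : IsLocalNodal P v) :
    IsLocalNodal P (-v) where
  continuousOn := hv.continuousOn.neg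
  affine_edge i t ht := by simp only [Pi.neg_apply, hv.affine_edge i t ht]; ring
  harmonic := hv.harmonic.neg
  memLp_rot := by
    have : rot (-v) = -rot v := by
      ext x i
      fin_cases i <;> simp [rot, fderiv_neg]
    rw [this]
    exact hv.memLp_rot.neg

/-- On each edge the function is a convex combination of the two end values, so the maximum over the
frontier is attained at a vertex. -/
theorem IsLocalNodal.le_of_vertex_le {P : Polygon} {v : Plane → ℝ} (hv : IsLocalNodal P v) {m : ℝ}
    (hm : ∀ i, v (P.vertex i) ≤ m) : ∀ x ∈ P.carrier, v x ≤ m := by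
  refine harmonic_le_of_frontier_le P.isCompact_carrier hv.continuousOn hv.harmonic ?_
  intro x hx
  rw [P.frontier_carrier, Set.mem_iUnion] at hx
  obtain ⟨i, hx⟩ := hx
  rw [segment_eq_image_lineMap] at hx
  obtain ⟨t, ht, rfl⟩ := hx
  rw [hv.affine_edge i t ht]
  nlinarith [hm i, hm (i + 1), ht.1, ht.2]

theorem IsLocalNodal.abs_le_of_vertex {P : Polygon} {v : Plane → ℝ} (hv : IsLocalNodal P v) {m : ℝ}
    (hm : ∀ i, |v (P.vertex i)| ≤ m) : ∀ x ∈ P.carrier, |v x| ≤ m := fun x hx =>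
  abs_le'.2 ⟨hv.le_of_vertex_le (fun i => (le_abs_self _).trans (hm i)) x hx,
    hv.neg.le_of_vertex_le (fun i => (neg_le_abs _).trans (hm i)) x hx⟩

/-! ### Star-shaped polygons as fans of triangles -/

namespace Polygon

variable (P : Polygon)

/-- The homothety with centre p and ratio t carries the disk to an open set containing the point,
and star-shapedness with respect to every point of the disk keeps this set in the polygon. -/
theorem lineMap_mem_interior {z y p : Plane} {r : ℝ}
    (hstar : ∀ y ∈ Metric.ball z r, StarConvex ℝ y P.carrier) (hy : y ∈ Metric.ball z r)
    (hp : p ∈ P.carrier) {t : ℝ} (ht0 : 0 < t) (ht1 : t ≤ 1) :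
    AffineMap.lineMap p y t ∈ interior P.carrier := by
  rw [mem_interior]
  refine ⟨(fun x => p + t • (x - p)) '' Metric.ball z r, ?_, ?_, ?_⟩
  · rintro _ ⟨x, hx, rfl⟩
    have := hstar x hx hp ht0.le (sub_nonneg.2 ht1) (by ring)
    convert this using 1
    module
  · have : (fun x : Plane => p + t • (x - p)) = AffineMap.homothety p t := by
      ext x
      simp [AffineMap.homothety_apply, add_comm]
    rw [this]
    exact AffineMap.homothety_isOpenMap p t ht0.ne' _ Metric.isOpen_ball
  · exact ⟨y, hy, by simp [AffineMap.lineMap_apply, add_comm]⟩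

/-- A ray from a point of the disk meets the boundary only once: of two boundary points on it, the
one nearer to y would be interior by `lineMap_mem_interior`. Injectivity of the fan parametrization
and disjointness of the triangles both follow. -/
theorem eq_of_lineMap_eq {z y p p' : Plane} {r : ℝ}
    (hstar : ∀ y ∈ Metric.ball z r, StarConvex ℝ y P.carrier) (hy : y ∈ Metric.ball z r)
    (hp : p ∈ frontier P.carrier) (hp' : p' ∈ frontier P.carrier) {s s' : ℝ} (hs : 0 < s)
    (hs' : 0 < s') (h : AffineMap.lineMap y p s = AffineMap.lineMap y p' s') :
    p = p' ∧ s = s' := by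
  have key : ∀ {p p' : Plane} {s s' : ℝ}, p ∈ frontier P.carrier → p' ∈ frontier P.carrier →
      0 < s → 0 < s' → AffineMap.lineMap y p s = AffineMap.lineMap y p' s' → ¬ s < s' := by
    intro p p' s s' hp hp' hs hs' h hlt
    have h1 : p' = AffineMap.lineMap p y (1 - s / s') := by
      simp only [AffineMap.lineMap_apply, vsub_eq_sub, vadd_eq_add, add_left_inj] at h ⊢
      have h2 : p' - y = (s / s') • (p - y) := by
        rw [div_eq_inv_mul, mul_smul, h, smul_smul, inv_mul_cancel₀ hs'.ne', one_smul]
      rw [← sub_add_cancel p' y, h2]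
      module
    have h3 : p' ∈ interior P.carrier := by
      rw [h1]
      refine P.lineMap_mem_interior hstar hy (P.isClosed_carrier.frontier_subset hp) ?_ ?_
      · rw [sub_pos, div_lt_one hs']
        exact hlt
      · have : 0 < s / s' := by positivity
        linarith
    exact hp'.2 h3
  have hss : s = s' := le_antisymm (not_lt.1 (key hp' hp hs' hs h.symm))
    (not_lt.1 (key hp hp' hs hs' h))
  subst hss
  refine ⟨?_, rfl⟩
  simp only [AffineMap.lineMap_apply, vsub_eq_sub, vadd_eq_add, add_left_inj] at h
  exact sub_left_injective (smul_right_injective _ hs.ne' h)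

theorem exists_frontier_on_ray {x y : Plane} (hx : x ∈ P.carrier) (hxy : x ≠ y) :
    ∃ p ∈ frontier P.carrier, ∃ s : ℝ, 0 < s ∧ s ≤ 1 ∧ AffineMap.lineMap y p s = x := by
  -- The boundary point is the last point of the polygon on the ray; its parameter is the greatest
  -- element of this compact set.
  set S : Set ℝ := {τ | 1 ≤ τ ∧ AffineMap.lineMap y x τ ∈ P.carrier} with hS
  have hcont : Continuous fun τ : ℝ => (AffineMap.lineMap y x τ : Plane) :=
    AffineMap.lineMap_continuous
  have hclosed : IsClosed S :=
    isClosed_Ici.inter (P.isClosed_carrier.preimage hcont)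
  obtain ⟨R, hR⟩ := P.isCompact_carrier.isBounded.subset_closedBall y
  have hpos : 0 < dist y x := dist_pos.2 hxy.symm
  have hsub : S ⊆ Set.Icc 1 (R / dist y x) := fun τ hτ => by
    refine ⟨hτ.1, ?_⟩
    have h1 := hR hτ.2
    rw [Metric.mem_closedBall, dist_lineMap_left, Real.norm_of_nonneg (by linarith [hτ.1])] at h1
    rwa [le_div_iff₀ hpos]
  have hcomp : IsCompact S := isCompact_Icc.of_isClosed_subset hclosed hsub
  obtain ⟨τ, hτ, hmax⟩ := hcomp.exists_isGreatest ⟨1, le_rfl, by simpa using hx⟩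
  have hτ0 : 0 < τ := by linarith [hτ.1]
  refine ⟨AffineMap.lineMap y x τ, ?_, τ⁻¹, by positivity, inv_le_one_of_one_le₀ hτ.1, ?_⟩
  · rw [P.isClosed_carrier.frontier_eq]
    refine ⟨hτ.2, fun hint => ?_⟩
    have h1 : ∀ᶠ t in nhds τ, AffineMap.lineMap y x t ∈ P.carrier :=
      hcont.continuousAt.eventually (mem_interior_iff_mem_nhds.1 hint)
    obtain ⟨ε, hε, h2⟩ := Metric.eventually_nhds_iff.1 h1
    have h3 : τ + ε / 2 ∈ S := by
      refine ⟨by linarith [hτ.1], h2 ?_⟩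
      rw [Real.dist_eq, add_sub_cancel_left, abs_of_pos (by positivity)]
      linarith
    linarith [hmax h3]
  · simp [AffineMap.lineMap_apply, smul_smul, inv_mul_cancel₀ hτ0.ne']

/-- The open triangle spanned by a point `y` and the `i`-th edge. -/
def fan (y : Plane) (i : Fin (P.k + 3)) : Set Plane :=
  (fun p : ℝ × ℝ => y + p.2 • ((P.vertex i - y) + p.1 • (P.vertex (i + 1) - P.vertex i))) ''
    (Set.Ioo 0 1 ×ˢ Set.Ioo 0 1)

theorem fan_param_eq (y : Plane) (i : Fin (P.k + 3)) (t s : ℝ) :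
    y + s • ((P.vertex i - y) + t • (P.vertex (i + 1) - P.vertex i)) =
      AffineMap.lineMap y (AffineMap.lineMap (P.vertex i) (P.vertex (i + 1)) t) s := by
  simp only [AffineMap.lineMap_apply, vsub_eq_sub, vadd_eq_add]
  module

theorem vertex_ne_succ (i : Fin (P.k + 3)) : P.vertex i ≠ P.vertex (i + 1) := fun h => by
  have h1 := P.vertex_injective h
  simp at h1

theorem lineMap_mem_edge (i : Fin (P.k + 3)) {t : ℝ} (ht : t ∈ Set.Ioo (0 : ℝ) 1) :
    AffineMap.lineMap (P.vertex i) (P.vertex (i + 1)) t ∈ P.edge i := by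
  rw [edge, segment_eq_image_lineMap]
  exact ⟨t, Set.Ioo_subset_Icc_self ht, rfl⟩

variable {P}

section Star

variable {z y : Plane} {r : ℝ} (hstar : ∀ y ∈ Metric.ball z r, StarConvex ℝ y P.carrier)
  (hy : y ∈ Metric.ball z r)

include hstar hy

theorem fan_injOn (i : Fin (P.k + 3)) :
    Set.InjOn (fun p : ℝ × ℝ =>
      y + p.2 • ((P.vertex i - y) + p.1 • (P.vertex (i + 1) - P.vertex i)))
      (Set.Ioo 0 1 ×ˢ Set.Ioo 0 1) := by
  rintro ⟨t, s⟩ ⟨ht, hs⟩ ⟨t', s'⟩ ⟨ht', hs'⟩ h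
  simp only [fan_param_eq] at h ht hs ht' hs'
  obtain ⟨h1, h2⟩ := P.eq_of_lineMap_eq hstar hy
    (P.edge_subset_frontier i (P.lineMap_mem_edge i ht))
    (P.edge_subset_frontier i (P.lineMap_mem_edge i ht')) hs.1 hs'.1 h
  exact Prod.ext (AffineMap.lineMap_injective ℝ (P.vertex_ne_succ i) h1) h2

theorem fan_disjoint : Pairwise (Function.onFun Disjoint (P.fan y)) := by
  intro i j hij
  rw [Function.onFun, Set.disjoint_left]
  rintro _ ⟨⟨t, s⟩, ⟨ht, hs⟩, rfl⟩ ⟨⟨t', s'⟩, ⟨ht', hs'⟩, h⟩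
  simp only [fan_param_eq] at h ht hs ht' hs'
  have h1 := (P.eq_of_lineMap_eq hstar hy
    (P.edge_subset_frontier j (P.lineMap_mem_edge j ht'))
    (P.edge_subset_frontier i (P.lineMap_mem_edge i ht)) hs'.1 hs.1 h).1
  have h2 := P.simple i j hij ⟨P.lineMap_mem_edge i ht, h1 ▸ P.lineMap_mem_edge j ht'⟩
  rcases h2.1 with h3 | h3
  · rw [AffineMap.lineMap_eq_left_iff] at h3
    exact h3.elim (P.vertex_ne_succ i) ht.1.ne'
  · rw [Set.mem_singleton_iff, AffineMap.lineMap_eq_right_iff] at h3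
    exact h3.elim (P.vertex_ne_succ i) ht.2.ne

theorem fan_subset_carrier (i : Fin (P.k + 3)) : P.fan y i ⊆ P.carrier := by
  rintro _ ⟨⟨t, s⟩, ⟨ht, hs⟩, rfl⟩
  simp only [fan_param_eq] at ht hs ⊢
  have h1 := P.edge_subset_carrier i (P.lineMap_mem_edge i ht)
  rw [← AffineMap.lineMap_apply_one_sub]
  exact interior_subset (P.lineMap_mem_interior hstar hy h1 (by linarith [hs.2])
    (by linarith [hs.1]))

theorem iUnion_fan_ae_eq : (⋃ i, P.fan y i) =ᵐ[volume] P.carrier := by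
  refine (LE.le.eventuallyLE (Set.iUnion_subset fun i =>
    fan_subset_carrier hstar hy i)).antisymm ?_
  -- The open triangles miss only the boundary and the spokes from y to the vertices.
  have hnull : volume (frontier P.carrier ∪ ⋃ i, segment ℝ y (P.vertex i)) = 0 := by
    rw [measure_union_null_iff]
    exact ⟨P.volume_frontier, measure_iUnion_null fun i => volume_segment_eq_zero _ _⟩
  rw [ae_le_set]
  refine measure_mono_null ?_ hnull
  rintro x ⟨hx, hxn⟩
  by_contra hcon
  rw [Set.mem_union, not_or] at hcon
  obtain ⟨hxf, hxs⟩ := hcon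
  have hxs' : ∀ i, x ∉ segment ℝ y (P.vertex i) := fun i h => hxs (Set.mem_iUnion.2 ⟨i, h⟩)
  have hxy : x ≠ y := fun h => hxs' 0 (h ▸ left_mem_segment ℝ _ _)
  obtain ⟨p, hp, s, hs0, hs1, rfl⟩ := P.exists_frontier_on_ray hx hxy
  have hs1' : s < 1 := lt_of_le_of_ne hs1 fun h => hxf (by simpa [h] using hp)
  rw [P.frontier_carrier, Set.mem_iUnion] at hp
  obtain ⟨i, hp⟩ := hp
  rw [segment_eq_image_lineMap] at hp
  obtain ⟨t, ht, rfl⟩ := hp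
  have hseg : ∀ q : Plane, AffineMap.lineMap y q s ∈ segment ℝ y q := fun q => by
    rw [segment_eq_image_lineMap]
    exact ⟨s, ⟨hs0.le, hs1⟩, rfl⟩
  have ht0 : 0 < t := lt_of_le_of_ne ht.1 fun h => hxs' i (by
    have := hseg (P.vertex i)
    simpa [← h] using this)
  have ht1 : t < 1 := lt_of_le_of_ne ht.2 fun h => hxs' (i + 1) (by
    have := hseg (P.vertex (i + 1))
    simpa [h] using this)
  exact hxn (Set.mem_iUnion.2 ⟨i, (t, s), ⟨⟨ht0, ht1⟩, hs0, hs1'⟩, P.fan_param_eq y i t s⟩)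

end Star

end Polygon

/-! ### Green's formula for radial fields -/

/-- The volume preserving identification of the plane with `ℝ × ℝ`. -/
def planeEquivProd : Plane ≃ᵐ ℝ × ℝ :=
  (MeasurableEquiv.toLp 2 (Fin 2 → ℝ)).symm.trans MeasurableEquiv.finTwoArrow

theorem volume_preserving_planeEquivProd : MeasurePreserving planeEquivProd :=
  (volume_preserving_finTwoArrow ℝ).comp
    (EuclideanSpace.volume_preserving_symm_measurableEquiv_toLp (Fin 2))

theorem setIntegral_fan_param (y a b : Plane) (f : Plane → ℝ)
    (hinj : Set.InjOn (fun p : ℝ × ℝ => y + p.2 • (a + p.1 • b)) (Set.Ioo 0 1 ×ˢ Set.Ioo 0 1)) :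
    ∫ x in (fun p : ℝ × ℝ => y + p.2 • (a + p.1 • b)) '' (Set.Ioo 0 1 ×ˢ Set.Ioo 0 1), f x =
      |cross a b| * ∫ p in Set.Ioo (0 : ℝ) 1 ×ˢ Set.Ioo (0 : ℝ) 1,
        p.2 * f (y + p.2 • (a + p.1 • b)) := by
  set Φ : ℝ × ℝ → Plane := fun p => y + p.2 • (a + p.1 • b) with hΦ
  set U : Set (ℝ × ℝ) := Set.Ioo 0 1 ×ˢ Set.Ioo 0 1 with hU
  set D : ℝ × ℝ → (ℝ × ℝ →L[ℝ] ℝ × ℝ) := fun p =>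
    (Matrix.toLin (.finTwoProd ℝ) (.finTwoProd ℝ)
      !![p.2 * b 0, a 0 + p.1 * b 0; p.2 * b 1, a 1 + p.1 * b 1]).toContinuousLinearMap with hD
  have hderiv : ∀ p, HasFDerivAt (planeEquivProd ∘ Φ) (D p) p := fun p => by
    have hc : ∀ i : Fin 2, HasFDerivAt (fun p : ℝ × ℝ => y i + p.2 * (a i + p.1 * b i))
        ((p.2 * b i) • ContinuousLinearMap.fst ℝ ℝ ℝ +
          (a i + p.1 * b i) • ContinuousLinearMap.snd ℝ ℝ ℝ) p := fun i => by
      have h1 : HasFDerivAt (fun p : ℝ × ℝ => y i + p.2 * (a i + p.1 * b i)) _ p :=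
        (HasFDerivAt.mul (hasFDerivAt_snd (𝕜 := ℝ) (p := p))
          ((hasFDerivAt_fst (𝕜 := ℝ) (p := p)).mul_const (b i) |>.const_add (a i))).const_add (y i)
      refine h1.congr_fderiv ?_
      ext <;> simp
    rw [hD]
    simp only [Matrix.toLin_finTwoProd_toContinuousLinearMap]
    exact (hc 0).prodMk (hc 1)
  -- The columns of the Jacobian are s b and a + t b, with (t, s) = p, so the t-term drops out of
  -- the determinant.
  have hdet : ∀ p, (D p).det = -(p.2 * cross a b) := fun p => by
    simp only [hD, LinearMap.det_toContinuousLinearMap, LinearMap.det_toLin,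
      Matrix.det_fin_two_of, cross]
    ring
  have hUm : MeasurableSet U := measurableSet_Ioo.prod measurableSet_Ioo
  have h1 : ∫ x in Φ '' U, f x = ∫ q in planeEquivProd '' (Φ '' U), f (planeEquivProd.symm q) := by
    rw [volume_preserving_planeEquivProd.setIntegral_image_emb
      planeEquivProd.measurableEmbedding]
    simp
  rw [h1, ← Set.image_comp, integral_image_eq_integral_abs_det_fderiv_smul volume hUm
    (fun p _ => (hderiv p).hasFDerivWithinAt) (planeEquivProd.injective.comp_injOn hinj),
    ← integral_const_mul]
  refine setIntegral_congr_fun hUm fun p hp => ?_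
  have hp2 : 0 < p.2 := hp.2.1
  simp only [hdet, Function.comp_apply, MeasurableEquiv.symm_apply_apply, abs_neg, abs_mul,
    abs_of_pos hp2, smul_eq_mul, hΦ]
  ring

theorem continuous_gradient {φ : Plane → ℝ} (hφ : ContDiff ℝ ∞ φ) : Continuous (gradient φ) :=
  (InnerProductSpace.toDual ℝ Plane).symm.continuous.comp (hφ.continuous_fderiv (by simp))

/-- The integrand is the derivative of s² φ(y + s p). With the Jacobian factor s this is the
divergence theorem for (x - y) φ along one ray. -/
theorem integral_ray {φ : Plane → ℝ} (hφ : ContDiff ℝ ∞ φ) (y p : Plane) :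
    ∫ s in Set.Ioo (0 : ℝ) 1, s * (⟪s • p, gradient φ (y + s • p)⟫ + 2 * φ (y + s • p)) =
      φ (y + p) := by
  rw [← integral_Ioc_eq_integral_Ioo, ← intervalIntegral.integral_of_le zero_le_one]
  have hd : ∀ s : ℝ, HasDerivAt (fun s : ℝ => s ^ 2 * φ (y + s • p))
      (s * (⟪s • p, gradient φ (y + s • p)⟫ + 2 * φ (y + s • p))) s := fun s => by
    have hl : HasDerivAt (fun s : ℝ => y + s • p) p s := by
      simpa using ((hasDerivAt_id s).smul_const p).const_add y
    have h1 := ((hφ.differentiable (by simp)) (y + s • p)).hasFDerivAt.comp_hasDerivAt s hl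
    have h2 := ((hasDerivAt_id s).pow 2).mul h1
    refine h2.congr_deriv ?_
    rw [inner_gradient_right, map_smul]
    simp
    ring
  rw [intervalIntegral.integral_eq_sub_of_hasDerivAt (fun s _ => hd s)]
  · simp
  · refine Continuous.intervalIntegrable ?_ _ _
    have := continuous_gradient hφ
    have := hφ.continuous
    fun_prop

theorem setIntegral_fan_green {φ : Plane → ℝ} (hφ : ContDiff ℝ ∞ φ) (y a b : Plane)
    (hinj : Set.InjOn (fun p : ℝ × ℝ => y + p.2 • (a + p.1 • b)) (Set.Ioo 0 1 ×ˢ Set.Ioo 0 1)) :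
    ∫ x in (fun p : ℝ × ℝ => y + p.2 • (a + p.1 • b)) '' (Set.Ioo 0 1 ×ˢ Set.Ioo 0 1),
        (⟪x - y, gradient φ x⟫ + 2 * φ x) =
      |cross a b| * ∫ t in (0 : ℝ)..1, φ (y + (a + t • b)) := by
  have hg := continuous_gradient hφ
  have hc := hφ.continuous
  rw [setIntegral_fan_param y a b _ hinj, Measure.volume_eq_prod, setIntegral_prod]
  · rw [intervalIntegral.integral_of_le zero_le_one, integral_Ioc_eq_integral_Ioo]
    congr 1
    refine setIntegral_congr_fun measurableSet_Ioo fun t _ => ?_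
    simp only [add_sub_cancel_left]
    exact integral_ray hφ y (a + t • b)
  · refine IntegrableOn.mono_set (t := Set.Icc 0 1 ×ˢ Set.Icc 0 1) ?_
      (Set.prod_mono Set.Ioo_subset_Icc_self Set.Ioo_subset_Icc_self)
    refine ContinuousOn.integrableOn_compact (isCompact_Icc.prod isCompact_Icc) ?_
    fun_prop

namespace Polygon

variable {P : Polygon}

theorem integrableOn_carrier_of_continuous {f : Plane → ℝ} (hf : Continuous f) :
    IntegrableOn f P.carrier :=
  hf.continuousOn.integrableOn_compact P.isCompact_carrier

theorem memLp_carrier_of_continuous {f : Plane → Plane} (hf : Continuous f) :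
    MemLp f 2 (volume.restrict P.carrier) := by
  rw [memLp_two_iff_integrable_sq_norm hf.aestronglyMeasurable]
  exact integrableOn_carrier_of_continuous (by fun_prop)

theorem green_radial {z y : Plane} {r : ℝ}
    (hstar : ∀ y ∈ Metric.ball z r, StarConvex ℝ y P.carrier) (hy : y ∈ Metric.ball z r)
    {φ : Plane → ℝ} (hφ : ContDiff ℝ ∞ φ) :
    ∫ x in P.carrier, (⟪x - y, gradient φ x⟫ + 2 * φ x) =
      ∑ i, |cross (P.vertex i - y) (P.vertex (i + 1) - P.vertex i)| *
        ∫ t in (0 : ℝ)..1, φ (AffineMap.lineMap (P.vertex i) (P.vertex (i + 1)) t) := by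
  have hg := continuous_gradient hφ
  have hc := hφ.continuous
  have hmeas : ∀ i, MeasurableSet (P.fan y i) := fun i => by
    refine (measurableSet_Ioo.prod measurableSet_Ioo).image_of_continuousOn_injOn ?_
      (fan_injOn hstar hy i)
    fun_prop
  rw [← setIntegral_congr_set (iUnion_fan_ae_eq hstar hy), integral_iUnion hmeas
    (fan_disjoint hstar hy), tsum_fintype]
  · refine Finset.sum_congr rfl fun i _ => ?_
    rw [fan, setIntegral_fan_green hφ y _ _ (fan_injOn hstar hy i)]
    congr 1
    refine intervalIntegral.integral_congr fun t _ => ?_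
    simp only [AffineMap.lineMap_apply, vsub_eq_sub, vadd_eq_add]
    congr 1
    abel
  · exact IntegrableOn.mono_set (integrableOn_carrier_of_continuous (by fun_prop))
      (Set.iUnion_subset fun i => fan_subset_carrier hstar hy i)

end Polygon

/-! ### Raviart-Thomas fields are local edge fields -/

theorem integrableOn_inner_of_memLp {S : Set Plane} {w G : Plane → Plane}
    (hw : MemLp w 2 (volume.restrict S)) (hG : MemLp G 2 (volume.restrict S)) :
    IntegrableOn (fun x => ⟪w x, G x⟫) S := by
  refine (hw.norm.integrable_mul hG.norm).mono' (hw.1.inner hG.1) ?_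
  exact Filter.Eventually.of_forall fun x => norm_inner_le_norm _ _

theorem continuous_rot {φ : Plane → ℝ} (hφ : ContDiff ℝ ∞ φ) : Continuous (rot φ) := by
  have h := hφ.continuous_fderiv (by simp)
  unfold rot
  fun_prop

theorem setIntegral_rt_rot_eq_zero {K : Set Plane} (a : Plane) (b : ℝ) {φ : Plane → ℝ}
    (hφ : ContDiff ℝ ∞ φ) (hc : HasCompactSupport φ) (hs : tsupport φ ⊆ K) :
    ∫ x in K, ⟪a + b • x, rot φ x⟫ = 0 := by
  have hcf : Continuous (fderiv ℝ φ) := hφ.continuous_fderiv (by simp)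
  have hcs : HasCompactSupport (fderiv ℝ φ) := hc.fderiv ℝ
  have hexp : ∀ x, ⟪a + b • x, rot φ x⟫ =
      (a 0 + b * x 0) * fderiv ℝ φ x (EuclideanSpace.single 1 1) -
        (a 1 + b * x 1) * fderiv ℝ φ x (EuclideanSpace.single 0 1) := fun x => by
    simp [rot, PiLp.inner_apply, Fin.sum_univ_two]
    ring
  have hint : ∀ (i : Fin 2) (v : Plane),
      Integrable fun x : Plane => (a i + b * x i) * fderiv ℝ φ x v := fun i v => by
    refine Continuous.integrable_of_hasCompactSupport (by fun_prop) ?_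
    refine HasCompactSupport.mul_left ?_
    exact hcs.comp_left (g := fun L : Plane →L[ℝ] ℝ => L v) (by simp)
  -- Integration by parts moves ∂_j onto a_i + b x_i, which does not depend on x_j.
  have hpart : ∀ (i j : Fin 2), i ≠ j →
      ∫ x : Plane, (a i + b * x i) * fderiv ℝ φ x (EuclideanSpace.single j 1) = 0 := by
    intro i j hij
    have hd : ∀ x : Plane, HasFDerivAt (fun x : Plane => a i + b * x i)
        (b • EuclideanSpace.proj i : Plane →L[ℝ] ℝ) x := fun x =>
      (((EuclideanSpace.proj i : Plane →L[ℝ] ℝ).hasFDerivAt).const_mul b).const_add (a i)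
    have hz : ∀ x : Plane, fderiv ℝ (fun x : Plane => a i + b * x i) x
        (EuclideanSpace.single j 1) = 0 := fun x => by
      rw [(hd x).fderiv]
      simp [hij]
    rw [integral_mul_fderiv_eq_neg_fderiv_mul_of_integrable]
    · simp only [hz, zero_mul, integral_zero, neg_zero]
    · simp only [hz, zero_mul]
      exact integrable_zero _ _ _
    · exact hint i _
    · exact Continuous.integrable_of_hasCompactSupport (by have := hφ.continuous; fun_prop)
        hc.mul_left
    · exact fun x _ => (hd x).differentiableAt
    · exact fun x _ => hφ.differentiable (by simp) x
  rw [setIntegral_eq_integral_of_forall_compl_eq_zero]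
  · simp_rw [hexp]
    rw [integral_sub (hint 0 _) (hint 1 _), hpart 0 1 (by simp), hpart 1 0 (by simp), sub_zero]
  · intro x hx
    have : fderiv ℝ φ x = 0 := by
      by_contra hne
      exact hx (hs (support_fderiv_subset ℝ hne))
    simp [hexp, this]

namespace IsLocalEdge

variable {P : Polygon} {v w : Plane → Plane}

theorem add (hv : IsLocalEdge P v) (hw : IsLocalEdge P w) : IsLocalEdge P (v + w) where
  memLp := hv.memLp.add hw.memLp
  div_normal := by
    obtain ⟨d, g, h⟩ := hv.div_normal
    obtain ⟨d', g', h'⟩ := hw.div_normal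
    refine ⟨d + d', g + g', fun φ hφ => ?_⟩
    have hG := P.memLp_carrier_of_continuous (continuous_gradient hφ)
    simp only [Pi.add_apply, inner_add_left]
    rw [integral_add (integrableOn_inner_of_memLp hv.memLp hG)
      (integrableOn_inner_of_memLp hw.memLp hG), h φ hφ, h' φ hφ]
    simp only [add_mul, Finset.sum_add_distrib]
    ring
  rot_free φ hφ hc hs := by
    have hG := P.memLp_carrier_of_continuous (continuous_rot hφ)
    simp only [Pi.add_apply, inner_add_left]
    rw [integral_add (integrableOn_inner_of_memLp hv.memLp hG)
      (integrableOn_inner_of_memLp hw.memLp hG), hv.rot_free φ hφ hc hs, hw.rot_free φ hφ hc hs,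
      add_zero]

theorem smul (c : ℝ) (hv : IsLocalEdge P v) : IsLocalEdge P (c • v) where
  memLp := hv.memLp.const_smul c
  div_normal := by
    obtain ⟨d, g, h⟩ := hv.div_normal
    refine ⟨c * d, c • g, fun φ hφ => ?_⟩
    simp only [Pi.smul_apply, real_inner_smul_left]
    rw [integral_const_mul, h φ hφ]
    simp only [smul_eq_mul, mul_assoc, ← Finset.mul_sum]
    ring
  rot_free φ hφ hc hs := by
    simp only [Pi.smul_apply, real_inner_smul_left]
    rw [integral_const_mul, hv.rot_free φ hφ hc hs, mul_zero]

theorem sub (hv : IsLocalEdge P v) (hw : IsLocalEdge P w) : IsLocalEdge P (v - w) := by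
  have := hv.add (hw.smul (-1))
  simpa [sub_eq_add_neg] using this

theorem radial {z y : Plane} {r : ℝ}
    (hstar : ∀ y ∈ Metric.ball z r, StarConvex ℝ y P.carrier) (hy : y ∈ Metric.ball z r) :
    IsLocalEdge P (fun x => x - y) where
  memLp := P.memLp_carrier_of_continuous (by fun_prop)
  div_normal := by
    -- The divergence of x - y is 2, and its normal component on an edge is the distance from y to
    -- the line of that edge.
    refine ⟨2, fun i => |cross (P.vertex i - y) (P.vertex (i + 1) - P.vertex i)| /
      dist (P.vertex i) (P.vertex (i + 1)), fun φ hφ => ?_⟩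
    have h := Polygon.green_radial hstar hy hφ
    have hg := continuous_gradient hφ
    have hc := hφ.continuous
    rw [integral_add (Polygon.integrableOn_carrier_of_continuous (by fun_prop))
      (Polygon.integrableOn_carrier_of_continuous (by fun_prop)), integral_const_mul] at h
    rw [eq_neg_add_iff_add_eq, add_comm, h]
    refine Finset.sum_congr rfl fun i _ => ?_
    have : dist (P.vertex i) (P.vertex (i + 1)) ≠ 0 := dist_ne_zero.2 (P.vertex_ne_succ i)
    rw [Polygon.edgeIntegral]
    field_simp
  rot_free φ hφ hc hs := by
    have := setIntegral_rt_rot_eq_zero (-y) 1 hφ hc (hs.trans interior_subset)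
    simpa [sub_eq_neg_add] using this

theorem const {z : Plane} {r : ℝ} (hr : 0 < r)
    (hstar : ∀ y ∈ Metric.ball z r, StarConvex ℝ y P.carrier) (a : Plane) :
    IsLocalEdge P (fun _ => a) := by
  -- A constant is a multiple of the difference of two radial fields; t is small enough that the
  -- second centre z - t a stays in the disk.
  set t : ℝ := r / (2 * (‖a‖ + 1)) with ht
  have ht0 : 0 < t := by positivity
  have hmem : z - t • a ∈ Metric.ball z r := by
    rw [mem_ball_iff_norm, sub_sub_cancel_left, norm_neg, norm_smul, Real.norm_of_nonneg ht0.le, ht,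
      div_mul_eq_mul_div, div_lt_iff₀ (by positivity)]
    nlinarith [norm_nonneg a]
  have h := ((radial hstar hmem).sub (radial hstar (Metric.mem_ball_self hr))).smul t⁻¹
  convert h using 1
  ext1 x
  simp [smul_smul, inv_mul_cancel₀ ht0.ne']

theorem of_isRT {z : Plane} {r : ℝ} (hr : 0 < r)
    (hstar : ∀ y ∈ Metric.ball z r, StarConvex ℝ y P.carrier) {q : Plane → Plane} (hq : IsRT q) :
    IsLocalEdge P q := by
  obtain ⟨a, b, h⟩ := hq
  have h1 := (const hr hstar (a + b • z)).add
    ((radial hstar (Metric.mem_ball_self hr)).smul b)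
  convert h1 using 1
  ext1 x
  simp only [h, Pi.add_apply, Pi.smul_apply]
  module

end IsLocalEdge

/-! ### Inverse estimate for Raviart-Thomas fields -/

namespace IsRT

theorem continuous {q : Plane → Plane} (hq : IsRT q) : Continuous q := by
  obtain ⟨a, b, h⟩ := hq
  rw [funext h]
  fun_prop

theorem zero : IsRT 0 := ⟨0, 0, fun x => by simp⟩

theorem add {q p : Plane → Plane} (hq : IsRT q) (hp : IsRT p) : IsRT (q + p) := by
  obtain ⟨a, b, h⟩ := hq
  obtain ⟨a', b', h'⟩ := hp
  exact ⟨a + a', b + b', fun x => by simp only [Pi.add_apply, h, h']; module⟩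

theorem smul {q : Plane → Plane} (c : ℝ) (hq : IsRT q) : IsRT (c • q) := by
  obtain ⟨a, b, h⟩ := hq
  exact ⟨c • a, c * b, fun x => by simp only [Pi.smul_apply, h]; module⟩

theorem sub {q p : Plane → Plane} (hq : IsRT q) (hp : IsRT p) : IsRT (q - p) := by
  have := hq.add (hp.smul (-1))
  simpa [sub_eq_add_neg] using this

theorem memLp {P : Polygon} {q : Plane → Plane} (hq : IsRT q) :
    MemLp q 2 (volume.restrict P.carrier) :=
  P.memLp_carrier_of_continuous hq.continuous

end IsRT

theorem setIntegral_ball_inner_eq_zero (c : Plane) (r : ℝ) :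
    ∫ x in Metric.ball (0 : Plane) r, ⟪c, x⟫ = 0 := by
  have h := (Measure.measurePreserving_neg (volume : Measure Plane)).setIntegral_preimage_emb
    (MeasurableEquiv.neg Plane).measurableEmbedding (fun x => ⟪c, x⟫) (Metric.ball 0 r)
  have hpre : (Neg.neg : Plane → Plane) ⁻¹' Metric.ball 0 r = Metric.ball 0 r := by
    ext x
    simp
  rw [hpre] at h
  simp only [inner_neg_right, integral_neg] at h
  linarith

theorem volume_real_ball (x : Plane) {r : ℝ} (hr : 0 ≤ r) :
    volume.real (Metric.ball x r) = r ^ 2 * volume.real (Metric.ball (0 : Plane) 1) := by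
  rw [measureReal_def, measureReal_def, Measure.addHaar_ball volume x hr, ENNReal.toReal_mul,
    ENNReal.toReal_ofReal (by positivity)]
  simp

theorem volume_real_unitBall_pos : 0 < volume.real (Metric.ball (0 : Plane) 1) :=
  ENNReal.toReal_pos (Metric.measure_ball_pos volume _ one_pos).ne' measure_ball_lt_top.ne

theorem integrableOn_ball_of_continuous {f : Plane → ℝ} (hf : Continuous f) (x : Plane) (r : ℝ) :
    IntegrableOn f (Metric.ball x r) :=
  (hf.continuousOn.integrableOn_compact (isCompact_closedBall x r)).mono_set
    Metric.ball_subset_closedBall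

theorem le_setIntegral_ball_norm_sq {r : ℝ} (hr : 0 < r) :
    3 / 16 * r ^ 4 * volume.real (Metric.ball (0 : Plane) 1) ≤
      ∫ x in Metric.ball (0 : Plane) r, ‖x‖ ^ 2 := by
  -- On this annulus ‖x‖² ≥ r²/4, and it has 3/4 of the area of the disk, whence 3/16.
  set A := Metric.ball (0 : Plane) r \ Metric.ball 0 (r / 2) with hA
  have hAm : MeasurableSet A := measurableSet_ball.diff measurableSet_ball
  have hAr : volume.real A = 3 / 4 * r ^ 2 * volume.real (Metric.ball (0 : Plane) 1) := by
    rw [measureReal_sdiff (Metric.ball_subset_ball (by linarith)) measurableSet_ball,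
      volume_real_ball _ hr.le, volume_real_ball _ (half_pos hr).le]
    ring
  have hfin : volume A ≠ ⊤ :=
    ((measure_mono Set.sdiff_subset).trans_lt measure_ball_lt_top).ne
  have hint : IntegrableOn (fun x : Plane => ‖x‖ ^ 2) (Metric.ball 0 r) :=
    integrableOn_ball_of_continuous (by fun_prop) 0 r
  calc 3 / 16 * r ^ 4 * volume.real (Metric.ball (0 : Plane) 1)
      = ∫ _ in A, (r / 2) ^ 2 := by
        rw [setIntegral_const, hAr, smul_eq_mul]
        ring
    _ ≤ ∫ x in A, ‖x‖ ^ 2 := by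
        refine setIntegral_mono_on (integrableOn_const hfin) (hint.mono_set Set.sdiff_subset) hAm ?_
        intro x hx
        have h2 : r / 2 ≤ ‖x‖ := by simpa using hx.2
        gcongr
    _ ≤ ∫ x in Metric.ball (0 : Plane) r, ‖x‖ ^ 2 :=
        setIntegral_mono_set hint (Filter.Eventually.of_forall fun x => by positivity)
          (LE.le.eventuallyLE Set.sdiff_subset)

theorem le_setIntegral_ball_rt (z c : Plane) (b : ℝ) {r : ℝ} (hr : 0 < r) :
    (r ^ 2 * ‖c‖ ^ 2 + 3 / 16 * r ^ 4 * b ^ 2) * volume.real (Metric.ball (0 : Plane) 1) ≤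
      ∫ x in Metric.ball z r, ‖c + b • (x - z)‖ ^ 2 := by
  have hshift : ∫ x in Metric.ball z r, ‖c + b • (x - z)‖ ^ 2 =
      ∫ x in Metric.ball (0 : Plane) r, ‖c + b • x‖ ^ 2 := by
    have h := (measurePreserving_sub_right (volume : Measure Plane) z).setIntegral_preimage_emb
      (MeasurableEquiv.subRight z).measurableEmbedding (fun x => ‖c + b • x‖ ^ 2)
      (Metric.ball 0 r)
    rw [← h]
    congr 2
    ext x
    simp [dist_eq_norm]
  have hexp : ∀ x : Plane, ‖c + b • x‖ ^ 2 = (‖c‖ ^ 2 + b ^ 2 * ‖x‖ ^ 2) + 2 * b * ⟪c, x⟫ := by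
    intro x
    rw [norm_add_sq_real, norm_smul, real_inner_smul_right, mul_pow, Real.norm_eq_abs, sq_abs]
    ring
  have hi : ∀ {f : Plane → ℝ}, Continuous f → IntegrableOn f (Metric.ball 0 r) :=
    fun hf => integrableOn_ball_of_continuous hf 0 r
  rw [hshift]
  simp_rw [hexp]
  rw [integral_add (hi (by fun_prop)) (hi (by fun_prop)), integral_add (hi (by fun_prop))
    (hi (by fun_prop)), integral_const_mul, integral_const_mul, setIntegral_ball_inner_eq_zero,
    setIntegral_const, volume_real_ball _ hr.le, smul_eq_mul]
  nlinarith [mul_le_mul_of_nonneg_left (le_setIntegral_ball_norm_sq hr) (sq_nonneg b)]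

section Star

variable {P : Polygon} {z : Plane} {r : ℝ} (hr : 0 < r)
  (hstar : ∀ y ∈ Metric.ball z r, StarConvex ℝ y P.carrier)

include hr hstar

theorem le_setIntegral_carrier_rt (c : Plane) (b : ℝ) :
    (r ^ 2 * ‖c‖ ^ 2 + 3 / 16 * r ^ 4 * b ^ 2) * volume.real (Metric.ball (0 : Plane) 1) ≤
      ∫ x in P.carrier, ‖c + b • (x - z)‖ ^ 2 :=
  (le_setIntegral_ball_rt z c b hr).trans
    (setIntegral_mono_set (Polygon.integrableOn_carrier_of_continuous (by fun_prop))
      (Filter.Eventually.of_forall fun x => by positivity)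
      (LE.le.eventuallyLE (P.ball_subset_carrier hstar)))

theorem IsRT.eq_zero_of_setIntegral {q : Plane → Plane} (hq : IsRT q)
    (h : ∫ x in P.carrier, ‖q x‖ ^ 2 = 0) : q = 0 := by
  obtain ⟨a, b, hab⟩ := hq
  have hq' : ∀ x, q x = (a + b • z) + b • (x - z) := fun x => by
    rw [hab]
    module
  have h1 := le_setIntegral_carrier_rt hr hstar (a + b • z) b
  simp_rw [← hq'] at h1
  rw [h] at h1
  have h2 : r ^ 2 * ‖a + b • z‖ ^ 2 + 3 / 16 * r ^ 4 * b ^ 2 ≤ 0 :=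
    nonpos_of_mul_nonpos_left h1 volume_real_unitBall_pos
  have h3 : 0 ≤ r ^ 2 * ‖a + b • z‖ ^ 2 := by positivity
  have h4 : 0 ≤ 3 / 16 * r ^ 4 * b ^ 2 := by positivity
  have h5 : r ^ 2 * ‖a + b • z‖ ^ 2 = 0 := by linarith
  have h6 : 3 / 16 * r ^ 4 * b ^ 2 = 0 := by linarith
  have hb : b = 0 := by simpa [hr.ne'] using h6
  have ha : a + b • z = 0 := by simpa [hr.ne'] using h5
  funext x
  rw [hq', ha, hb]
  simp

/-- Writing q = c + b(x - z), both sides compare with ‖c‖² and b² h². The disk of radius ρh bounds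
the integral below, and a disk of radius h bounds the area above. Matching coefficients needs 2/ρ²
for c and (32/3)/ρ⁴ for b; 11 rounds up 32/3. -/
theorem IsRT.volume_mul_norm_sq_le {ρ : ℝ} (hρ : 0 < ρ) (hrρ : r = ρ * P.diam)
    {q : Plane → Plane} (hq : IsRT q) {x : Plane} (hx : x ∈ P.carrier) :
    volume.real P.carrier * ‖q x‖ ^ 2 ≤
      (2 / ρ ^ 2 + 11 / ρ ^ 4) * ∫ y in P.carrier, ‖q y‖ ^ 2 := by
  obtain ⟨a, b, hab⟩ := hq
  have hq' : ∀ x, q x = (a + b • z) + b • (x - z) := fun x => by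
    rw [hab]
    module
  have h1 := le_setIntegral_carrier_rt hr hstar (a + b • z) b
  simp_rw [← hq'] at h1
  set c := a + b • z
  set V := volume.real (Metric.ball (0 : Plane) 1)
  set h := P.diam
  have hV : 0 < V := volume_real_unitBall_pos
  have hh : 0 < h := P.diam_pos
  have hsub := P.carrier_subset_closedBall (P.ball_subset_carrier hstar (Metric.mem_ball_self hr))
  have hvol : volume.real P.carrier ≤ h ^ 2 * V := by
    rw [← volume_real_ball z hh.le, ← Measure.addHaar_real_closedBall_eq_addHaar_real_ball]
    exact measureReal_mono hsub measure_closedBall_lt_top.ne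
  have hxz : ‖x - z‖ ≤ h := by simpa [dist_eq_norm] using hsub hx
  have hnorm : ‖q x‖ ^ 2 ≤ 2 * (‖c‖ ^ 2 + b ^ 2 * h ^ 2) := by
    have h2 : ‖q x‖ ≤ ‖c‖ + |b| * h := by
      rw [hq']
      refine (norm_add_le _ _).trans ?_
      rw [norm_smul, Real.norm_eq_abs]
      gcongr
    have h3 : ‖q x‖ ^ 2 ≤ (‖c‖ + |b| * h) ^ 2 := by gcongr
    have h4 : (|b| * h) ^ 2 = b ^ 2 * h ^ 2 := by rw [mul_pow, sq_abs]
    nlinarith [sq_nonneg (‖c‖ - |b| * h)]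
  calc volume.real P.carrier * ‖q x‖ ^ 2
      ≤ (h ^ 2 * V) * (2 * (‖c‖ ^ 2 + b ^ 2 * h ^ 2)) := by gcongr
    _ ≤ (2 / ρ ^ 2 + 11 / ρ ^ 4) *
        ((r ^ 2 * ‖c‖ ^ 2 + 3 / 16 * r ^ 4 * b ^ 2) * V) := by
        have e : (2 / ρ ^ 2 + 11 / ρ ^ 4) *
            ((r ^ 2 * ‖c‖ ^ 2 + 3 / 16 * r ^ 4 * b ^ 2) * V) =
            (h ^ 2 * V) * (2 * (‖c‖ ^ 2 + b ^ 2 * h ^ 2)) +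
              V * (1 / 16 * h ^ 4 * b ^ 2 + 3 / 8 * ρ ^ 2 * h ^ 4 * b ^ 2
                + 11 / ρ ^ 2 * h ^ 2 * ‖c‖ ^ 2) := by
          rw [hrρ]
          field_simp
          ring
        rw [e]
        have : 0 ≤ V * (1 / 16 * h ^ 4 * b ^ 2 + 3 / 8 * ρ ^ 2 * h ^ 4 * b ^ 2
                + 11 / ρ ^ 2 * h ^ 2 * ‖c‖ ^ 2) := by positivity
        linarith
    _ ≤ _ := by gcongr

end Star

/-! ### The projection Π^{RT} -/

theorem exists_rtProj (P : Polygon) {w : Plane → Plane}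
    (hw : MemLp w 2 (volume.restrict P.carrier)) :
    ∃ q, IsRT q ∧ ∀ p, IsRT p → ∫ x in P.carrier, ⟪w x - q x, p x⟫ = 0 := by
  have hq : ∀ s : Plane × ℝ, IsRT fun x => s.1 + s.2 • x := fun s => ⟨s.1, s.2, fun _ => rfl⟩
  have hm : ∀ s : Plane × ℝ, MemLp (fun x : Plane => s.1 + s.2 • x) 2
      (volume.restrict P.carrier) := fun s => (hq s).memLp
  -- The Raviart-Thomas fields form a finite-dimensional, hence complete, subspace of L², so the
  -- orthogonal projection exists; a preimage under T recovers an actual field rather than a class.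
  let T : (Plane × ℝ) →ₗ[ℝ] Lp Plane 2 (volume.restrict P.carrier) :=
    { toFun := fun s => (hm s).toLp _
      map_add' := fun s t => by
        rw [← MemLp.toLp_add]
        refine (MemLp.toLp_eq_toLp_iff _ _).2 (Filter.Eventually.of_forall fun x => ?_)
        simp only [Prod.fst_add, Prod.snd_add, Pi.add_apply]
        module
      map_smul' := fun c s => by
        rw [RingHom.id_apply, ← MemLp.toLp_const_smul]
        refine (MemLp.toLp_eq_toLp_iff _ _).2 (Filter.Eventually.of_forall fun x => ?_)
        simp only [Prod.smul_fst, Prod.smul_snd, Pi.smul_apply, smul_eq_mul]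
        module }
  have hcomp : CompleteSpace (LinearMap.range T) := FiniteDimensional.complete ℝ _
  obtain ⟨s, hs⟩ : (LinearMap.range T).starProjection (hw.toLp w) ∈ LinearMap.range T :=
    Submodule.starProjection_apply_mem _ _
  refine ⟨fun x => s.1 + s.2 • x, hq s, ?_⟩
  rintro p ⟨a, b, hp⟩
  have h := (Submodule.mem_orthogonal' _ _).1
    ((LinearMap.range T).sub_starProjection_mem_orthogonal (hw.toLp w)) (T (a, b)) ⟨_, rfl⟩
  rw [← hs] at h
  change ⟪hw.toLp w - (hm s).toLp _, (hm (a, b)).toLp _⟫ = 0 at h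
  rw [← MemLp.toLp_sub, L2.inner_def] at h
  rw [← h]
  refine integral_congr_ae ?_
  filter_upwards [(hw.sub (hm s)).coeFn_toLp, (hm (a, b)).coeFn_toLp] with x h1 h2
  rw [h1, h2, hp]
  rfl

theorem isRT_rtProj (P : Polygon) (w : Plane → Plane) : IsRT (rtProj P w) := by
  unfold rtProj
  split_ifs with h
  · exact h.choose_spec.1
  · exact IsRT.zero

theorem setIntegral_sub_rtProj_inner {P : Polygon} {w : Plane → Plane}
    (hw : MemLp w 2 (volume.restrict P.carrier)) {p : Plane → Plane} (hp : IsRT p) :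
    ∫ x in P.carrier, ⟪w x - rtProj P w x, p x⟫ = 0 := by
  have h := exists_rtProj P hw
  have h1 : rtProj P w = h.choose := by
    unfold rtProj
    rw [dif_pos h]
  rw [h1]
  exact h.choose_spec.2 p hp

theorem integrableOn_sub_inner {P : Polygon} {w q p : Plane → Plane}
    (hw : MemLp w 2 (volume.restrict P.carrier)) (hq : IsRT q) (hp : IsRT p) :
    IntegrableOn (fun x => ⟪w x - q x, p x⟫) P.carrier :=
  integrableOn_inner_of_memLp (hw.sub hq.memLp) hp.memLp

theorem setIntegral_norm_sq_eq_add {P : Polygon} {w : Plane → Plane}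
    (hw : MemLp w 2 (volume.restrict P.carrier)) :
    ∫ x in P.carrier, ‖w x‖ ^ 2 =
      (∫ x in P.carrier, ‖rtProj P w x‖ ^ 2) + ∫ x in P.carrier, ‖w x - rtProj P w x‖ ^ 2 := by
  have hp := isRT_rtProj P w
  have h0 := setIntegral_sub_rtProj_inner hw hp
  have hi1 : IntegrableOn (fun x => ‖rtProj P w x‖ ^ 2) P.carrier :=
    hp.memLp.integrable_norm_pow two_ne_zero
  have hi2 : IntegrableOn (fun x => ‖w x - rtProj P w x‖ ^ 2) P.carrier :=
    (hw.sub hp.memLp).integrable_norm_pow two_ne_zero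
  have hi3 : IntegrableOn (fun x => ⟪w x - rtProj P w x, rtProj P w x⟫) P.carrier :=
    integrableOn_sub_inner hw hp hp
  have hexp : ∀ x, ‖w x‖ ^ 2 = ‖rtProj P w x‖ ^ 2 + ‖w x - rtProj P w x‖ ^ 2 +
      2 * ⟪w x - rtProj P w x, rtProj P w x⟫ := fun x => by
    have := norm_add_sq_real (w x - rtProj P w x) (rtProj P w x)
    rw [sub_add_cancel] at this
    rw [this]
    ring
  simp_rw [hexp]
  have hi4 : IntegrableOn (fun x => ‖rtProj P w x‖ ^ 2 + ‖w x - rtProj P w x‖ ^ 2) P.carrier :=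
    hi1.add hi2
  rw [integral_add hi4 (hi3.const_mul 2), integral_add hi1 hi2, integral_const_mul, h0]
  ring

section Star

variable {P : Polygon} {z : Plane} {r : ℝ} (hr : 0 < r)
  (hstar : ∀ y ∈ Metric.ball z r, StarConvex ℝ y P.carrier)

include hr hstar

/-- Two candidates differ by a field orthogonal to itself, which vanishes identically because the
cell contains a disk. This uniqueness is what makes the chosen projection linear and idempotent. -/
theorem rtProj_eq_of_orthogonal {w q : Plane → Plane}
    (hw : MemLp w 2 (volume.restrict P.carrier)) (hq : IsRT q)
    (h : ∀ p, IsRT p → ∫ x in P.carrier, ⟪w x - q x, p x⟫ = 0) : rtProj P w = q := by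
  have hp := isRT_rtProj P w
  have hd := hp.sub hq
  rw [← sub_eq_zero]
  refine IsRT.eq_zero_of_setIntegral hr hstar hd ?_
  have h1 := h _ hd
  have h2 := setIntegral_sub_rtProj_inner hw hd
  have h3 : ∀ x, ‖(rtProj P w - q) x‖ ^ 2 = ⟪w x - q x, (rtProj P w - q) x⟫ -
      ⟪w x - rtProj P w x, (rtProj P w - q) x⟫ := fun x => by
    rw [← inner_sub_left, ← real_inner_self_eq_norm_sq]
    congr 1
    simp
  simp_rw [h3]
  rw [integral_sub (integrableOn_sub_inner hw hq hd) (integrableOn_sub_inner hw hp hd),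
    h1, h2, sub_zero]

theorem rtProj_add {v w : Plane → Plane} (hv : MemLp v 2 (volume.restrict P.carrier))
    (hw : MemLp w 2 (volume.restrict P.carrier)) :
    rtProj P (v + w) = rtProj P v + rtProj P w := by
  have hpv := isRT_rtProj P v
  have hpw := isRT_rtProj P w
  refine rtProj_eq_of_orthogonal hr hstar (hv.add hw) (hpv.add hpw) fun p hp => ?_
  have h : ∀ x, ⟪(v + w) x - (rtProj P v + rtProj P w) x, p x⟫ =
      ⟪v x - rtProj P v x, p x⟫ + ⟪w x - rtProj P w x, p x⟫ := fun x => by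
    rw [← inner_add_left]
    congr 1
    simp only [Pi.add_apply]
    abel
  simp_rw [h]
  rw [integral_add (integrableOn_sub_inner hv hpv hp) (integrableOn_sub_inner hw hpw hp),
    setIntegral_sub_rtProj_inner hv hp, setIntegral_sub_rtProj_inner hw hp, add_zero]

theorem rtProj_smul (c : ℝ) {v : Plane → Plane} (hv : MemLp v 2 (volume.restrict P.carrier)) :
    rtProj P (c • v) = c • rtProj P v := by
  have hpv := isRT_rtProj P v
  refine rtProj_eq_of_orthogonal hr hstar (hv.const_smul c) (hpv.smul c) fun p hp => ?_
  simp only [Pi.smul_apply, ← smul_sub, real_inner_smul_left]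
  rw [integral_const_mul, setIntegral_sub_rtProj_inner hv hp, mul_zero]

theorem rtProj_sub_rtProj {v : Plane → Plane} (hv : MemLp v 2 (volume.restrict P.carrier)) :
    rtProj P (v - rtProj P v) = 0 := by
  refine rtProj_eq_of_orthogonal hr hstar (hv.sub (isRT_rtProj P v).memLp) IsRT.zero
    fun p hp => ?_
  simpa using setIntegral_sub_rtProj_inner hv hp

end Star

/-! ### Cauchy-Schwarz, affine functions and nodal interpolation -/

theorem sq_setIntegral_inner_le {E : Type*} [NormedAddCommGroup E] [InnerProductSpace ℝ E]
    {S : Set Plane} {f g : Plane → E} (hf : IntegrableOn (fun x => ‖f x‖ ^ 2) S)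
    (hg : IntegrableOn (fun x => ‖g x‖ ^ 2) S) (hfg : IntegrableOn (fun x => ⟪f x, g x⟫) S) :
    (∫ x in S, ⟪f x, g x⟫) ^ 2 ≤ (∫ x in S, ‖f x‖ ^ 2) * ∫ x in S, ‖g x‖ ^ 2 := by
  have h : ∀ t : ℝ, 0 ≤ (∫ x in S, ‖g x‖ ^ 2) * (t * t) + (2 * ∫ x in S, ⟪f x, g x⟫) * t +
      ∫ x in S, ‖f x‖ ^ 2 := fun t => by
    have h0 : 0 ≤ ∫ x in S, ‖f x + t • g x‖ ^ 2 := integral_nonneg fun x => by positivity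
    have hexp : ∀ x, ‖f x + t • g x‖ ^ 2 =
        (‖f x‖ ^ 2 + (2 * t) * ⟪f x, g x⟫) + t ^ 2 * ‖g x‖ ^ 2 := fun x => by
      rw [norm_add_sq_real, real_inner_smul_right, norm_smul, mul_pow, Real.norm_eq_abs, sq_abs]
      ring
    have h1 : IntegrableOn (fun x => ‖f x‖ ^ 2 + (2 * t) * ⟪f x, g x⟫) S :=
      hf.add (hfg.const_mul _)
    simp_rw [hexp] at h0
    rw [integral_add h1 (hg.const_mul _), integral_add hf (hfg.const_mul _), integral_const_mul,
      integral_const_mul] at h0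
    linarith
  have := discrim_le_zero h
  rw [discrim] at this
  linarith

theorem abs_cross_le (a b : Plane) : |cross a b| ≤ ‖a‖ * ‖b‖ := by
  refine abs_le_of_sq_le_sq ?_ (by positivity)
  rw [mul_pow, EuclideanSpace.norm_sq_eq, EuclideanSpace.norm_sq_eq, cross]
  simp only [Fin.sum_univ_two, Real.norm_eq_abs, sq_abs]
  nlinarith [sq_nonneg (a 0 * b 0 + a 1 * b 1)]

namespace IsAffineFun

theorem zero : IsAffineFun 0 := ⟨0, 0, fun x => by simp⟩

theorem continuous {q : Plane → ℝ} (hq : IsAffineFun q) : Continuous q := by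
  obtain ⟨a, b, h⟩ := hq
  rw [funext h]
  fun_prop

theorem hasFDerivAt {q : Plane → ℝ} {a : ℝ} {b : Plane} (h : ∀ x, q x = a + ⟪b, x⟫) (x : Plane) :
    HasFDerivAt q (innerSL ℝ b) x := by
  rw [funext h]
  exact ((innerSL ℝ b).hasFDerivAt (x := x)).const_add a

open InnerProductSpace Laplacian in
theorem harmonicAt {q : Plane → ℝ} (hq : IsAffineFun q) (x : Plane) : HarmonicAt q x := by
  obtain ⟨a, b, h⟩ := hq
  constructor
  · rw [funext h]
    exact contDiffAt_const.add (contDiffAt_const.inner ℝ contDiffAt_id)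
  · refine Filter.Eventually.of_forall fun y => ?_
    rw [laplacian_eq_iteratedFDeriv_orthonormalBasis _ (EuclideanSpace.basisFun (Fin 2) ℝ)]
    have h1 : fderiv ℝ q = fun _ => innerSL ℝ b := funext fun x => (hasFDerivAt h x).fderiv
    simp [iteratedFDeriv_two_apply, h1]

theorem isLocalNodal {q : Plane → ℝ} (hq : IsAffineFun q) (P : Polygon) : IsLocalNodal P q where
  continuousOn := hq.continuous.continuousOn
  affine_edge i t _ := by
    obtain ⟨a, b, h⟩ := hq
    simp only [h, AffineMap.lineMap_apply, vsub_eq_sub, vadd_eq_add, inner_add_right,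
      real_inner_smul_right, inner_sub_right]
    ring
  harmonic x _ := hq.harmonicAt x
  memLp_rot := by
    obtain ⟨a, b, h⟩ := hq
    have h1 : rot q = fun _ => !₂[innerSL ℝ b (EuclideanSpace.single 1 1),
        -innerSL ℝ b (EuclideanSpace.single 0 1)] := by
      funext x
      rw [rot, (hasFDerivAt h x).fderiv]
    rw [h1]
    exact memLp_const _

end IsAffineFun

namespace IsLocalNodal

variable {P : Polygon} {v w : Plane → ℝ}

theorem sub (hv : IsLocalNodal P v) (hw : IsLocalNodal P w) : IsLocalNodal P (v - w) where
  continuousOn := hv.continuousOn.sub hw.continuousOn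
  affine_edge i t ht := by
    simp only [Pi.sub_apply, hv.affine_edge i t ht, hw.affine_edge i t ht]
    ring
  harmonic := hv.harmonic.sub hw.harmonic
  memLp_rot := by
    refine (hv.memLp_rot.sub hw.memLp_rot).ae_eq ?_
    -- `rot` is additive only where both functions are differentiable, that is in the interior,
    -- which suffices almost everywhere.
    rw [← Measure.restrict_congr_set P.interior_ae_eq_carrier]
    filter_upwards [ae_restrict_mem isOpen_interior.measurableSet] with x hx
    have h1 : DifferentiableAt ℝ v x := (hv.harmonic x hx).1.differentiableAt (by simp)
    have h2 : DifferentiableAt ℝ w x := (hw.harmonic x hx).1.differentiableAt (by simp)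
    ext i
    fin_cases i
    · simp [rot, fderiv_sub h1 h2]
    · simp [rot, fderiv_sub h1 h2]
      ring

theorem integrableOn_mul (hv : IsLocalNodal P v) (hw : IsLocalNodal P w) :
    IntegrableOn (fun x => v x * w x) P.carrier :=
  (hv.continuousOn.mul hw.continuousOn).integrableOn_compact P.isCompact_carrier

theorem integrableOn_sq (hv : IsLocalNodal P v) : IntegrableOn (fun x => v x ^ 2) P.carrier :=
  (hv.continuousOn.pow 2).integrableOn_compact P.isCompact_carrier

end IsLocalNodal

theorem IsNodal.zero {Ω : Set Plane} (M : Mesh Ω) : IsNodal M 0 := fun c =>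
  IsAffineFun.zero.isLocalNodal (M.cell c)

theorem isNodal_interp {Ω : Set Plane} (M : Mesh Ω) (f : Plane → ℝ) : IsNodal M (interp M f) := by
  unfold interp
  split_ifs with h
  · exact h.choose_spec.1
  · exact IsNodal.zero M

theorem isLocalNodal_localInterp (P : Polygon) (f : Plane → ℝ) :
    IsLocalNodal P (localInterp P f) := by
  unfold localInterp
  split_ifs with h
  · exact h.choose_spec.1
  · exact IsAffineFun.zero.isLocalNodal P

/-- An inequality rather than an equality, so that it also covers the default value 0 of
`localInterp`; existence of the interpolant is then not needed. -/
theorem abs_localInterp_vertex_le (P : Polygon) (f : Plane → ℝ) (i : Fin (P.k + 3)) :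
    |localInterp P f (P.vertex i)| ≤ |f (P.vertex i)| := by
  unfold localInterp
  split_ifs with h
  · rw [h.choose_spec.2 i]
  · simp

theorem exists_vertex_localInterp_sq_le (P : Polygon) (f : Plane → ℝ) :
    ∃ i, ∫ x in P.carrier, localInterp P f x ^ 2 ≤ volume.real P.carrier * f (P.vertex i) ^ 2 := by
  obtain ⟨i, hi⟩ := Finite.exists_max fun i => |f (P.vertex i)|
  refine ⟨i, ?_⟩
  have hw := isLocalNodal_localInterp P f
  have hle := hw.abs_le_of_vertex fun j => (abs_localInterp_vertex_le P f j).trans (hi j)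
  rw [← smul_eq_mul, ← setIntegral_const]
  refine setIntegral_mono_on hw.integrableOn_sq (integrableOn_const P.volume_carrier_lt_top.ne)
    P.measurableSet_carrier fun x hx => ?_
  rw [← sq_abs (localInterp P f x), ← sq_abs (f (P.vertex i))]
  exact pow_le_pow_left₀ (abs_nonneg _) (hle x hx) 2

theorem Mesh.norm_le_supNorm {Ω : Set Plane} (M : Mesh Ω) {u : Plane → Plane}
    (hu : ContinuousOn u (closure Ω)) {x : Plane} (hx : x ∈ closure Ω) : ‖u x‖ ≤ supNorm Ω u := by
  have hb : BddAbove (Set.range fun x : closure Ω => ‖u x‖) := by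
    have := (M.isCompact_closure.image_of_continuousOn hu.norm).bddAbove
    rwa [Set.image_eq_range] at this
  exact le_ciSup hb ⟨x, hx⟩

theorem supNorm_nonneg (Ω : Set Plane) (u : Plane → Plane) : 0 ≤ supNorm Ω u :=
  Real.iSup_nonneg fun _ => norm_nonneg _

/-! ### Discrete forms in one cell -/

namespace Forms

variable {Ω : Set Plane} {M : Mesh Ω} {F : Forms M} {cP s₀ s₁ : ℝ}

section Local

variable (hF : F.IsAdmissible cP s₀ s₁)

include hF

theorem localNodal_self_nonneg (c : Fin M.numCells) (v : Plane → ℝ) : 0 ≤ F.localNodal c v v :=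
  add_nonneg (integral_nonneg fun _ => mul_self_nonneg _) (hF.nodal_nonneg c _)

theorem localEdge_self_nonneg (c : Fin M.numCells) (w : Plane → Plane) : 0 ≤ F.localEdge c w w :=
  add_nonneg (integral_nonneg fun _ => real_inner_self_nonneg) (hF.edge_nonneg c _)

theorem localEdge_comm (c : Fin M.numCells) (v w : Plane → Plane) :
    F.localEdge c v w = F.localEdge c w v := by
  simp only [localEdge, hF.edge_symm c (v - rtProj (M.cell c) v), real_inner_comm]

theorem localNodal_sq_le (c : Fin M.numCells) {v w : Plane → ℝ} (hv : IsLocalNodal (M.cell c) v)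
    (hw : IsLocalNodal (M.cell c) w) :
    F.localNodal c v w ^ 2 ≤ F.localNodal c v v * F.localNodal c w w := by
  have hv' := (hF.proj_affine c v hv).isLocalNodal (M.cell c)
  have hw' := (hF.proj_affine c w hw).isLocalNodal (M.cell c)
  have h1 := sq_setIntegral_inner_le (S := (M.cell c).carrier) (f := F.nodalProj c v)
    (g := F.nodalProj c w) (by simpa using hv'.integrableOn_sq) (by simpa using hw'.integrableOn_sq)
    (by simpa using hw'.integrableOn_mul hv')
  have h2 := LinearMap.BilinForm.apply_sq_le_of_symm (F.nodalStab c) (hF.nodal_nonneg c)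
    ⟨fun x y => hF.nodal_symm c x y⟩ (v - F.nodalProj c v) (w - F.nodalProj c w)
  have h3 : 0 ≤ ∫ x in (M.cell c).carrier, F.nodalProj c v x ^ 2 :=
    integral_nonneg fun x => sq_nonneg _
  have h4 : 0 ≤ ∫ x in (M.cell c).carrier, F.nodalProj c w x ^ 2 :=
    integral_nonneg fun x => sq_nonneg _
  have h5 := hF.nodal_nonneg c (v - F.nodalProj c v)
  have h6 := hF.nodal_nonneg c (w - F.nodalProj c w)
  simp only [Real.inner_apply, Real.norm_eq_abs, sq_abs] at h1
  simp only [localNodal, ← pow_two]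
  -- The form has two summands, integral and stabilization; Cauchy-Schwarz for each is combined by
  -- the discrete inequality over two indices.
  have h7 := Finset.sum_sq_le_sum_mul_sum_of_sq_le_mul (Finset.univ : Finset (Fin 2))
    (r := ![_, _]) (f := ![_, _]) (g := ![_, _]) (Fin.forall_fin_two.2 ⟨fun _ => h3, fun _ => h5⟩)
    (Fin.forall_fin_two.2 ⟨fun _ => h4, fun _ => h6⟩)
    (Fin.forall_fin_two.2 ⟨fun _ => h1, fun _ => h2⟩)
  simpa [Fin.sum_univ_two] using h7

theorem localEdge_sq_le (c : Fin M.numCells) (v w : Plane → Plane) :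
    F.localEdge c v w ^ 2 ≤ F.localEdge c v v * F.localEdge c w w := by
  have hv' := isRT_rtProj (M.cell c) v
  have hw' := isRT_rtProj (M.cell c) w
  have h1 := sq_setIntegral_inner_le (S := (M.cell c).carrier)
    (hv'.memLp.integrable_norm_pow two_ne_zero) (hw'.memLp.integrable_norm_pow two_ne_zero)
    (integrableOn_inner_of_memLp hv'.memLp hw'.memLp)
  have h2 := LinearMap.BilinForm.apply_sq_le_of_symm (F.edgeStab c) (hF.edge_nonneg c)
    ⟨fun x y => hF.edge_symm c x y⟩ (v - rtProj (M.cell c) v) (w - rtProj (M.cell c) w)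
  have h3 : 0 ≤ ∫ x in (M.cell c).carrier, ‖rtProj (M.cell c) v x‖ ^ 2 :=
    integral_nonneg fun x => sq_nonneg _
  have h4 : 0 ≤ ∫ x in (M.cell c).carrier, ‖rtProj (M.cell c) w x‖ ^ 2 :=
    integral_nonneg fun x => sq_nonneg _
  have h5 := hF.edge_nonneg c (v - rtProj (M.cell c) v)
  have h6 := hF.edge_nonneg c (w - rtProj (M.cell c) w)
  simp only [localEdge, real_inner_self_eq_norm_sq]
  have h7 := Finset.sum_sq_le_sum_mul_sum_of_sq_le_mul (Finset.univ : Finset (Fin 2))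
    (r := ![_, _]) (f := ![_, _]) (g := ![_, _]) (Fin.forall_fin_two.2 ⟨fun _ => h3, fun _ => h5⟩)
    (Fin.forall_fin_two.2 ⟨fun _ => h4, fun _ => h6⟩)
    (Fin.forall_fin_two.2 ⟨fun _ => h1, fun _ => h2⟩)
  simpa [Fin.sum_univ_two] using h7

theorem isLocalNodal_sub_proj (c : Fin M.numCells) {v : Plane → ℝ}
    (hv : IsLocalNodal (M.cell c) v) :
    IsLocalNodal (M.cell c) (v - F.nodalProj c v) ∧ F.nodalProj c (v - F.nodalProj c v) = 0 := by
  have hq := hF.proj_affine c v hv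
  refine ⟨hv.sub (hq.isLocalNodal _), ?_⟩
  rw [map_sub, hF.proj_eq c _ hq, sub_self]

theorem localNodal_self_le (hs₁ : 0 ≤ s₁) (c : Fin M.numCells) {v : Plane → ℝ}
    (hv : IsLocalNodal (M.cell c) v) :
    F.localNodal c v v ≤
      (cP ^ 2 + s₁ * (2 + 2 * cP ^ 2)) * ∫ x in (M.cell c).carrier, v x ^ 2 := by
  obtain ⟨h1, h2⟩ := isLocalNodal_sub_proj hF c hv
  have hq := (hF.proj_affine c v hv).isLocalNodal (M.cell c)
  have h3 := hF.nodal_upper c _ h1 h2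
  have h4 := hF.proj_bound c v hv
  have h5 : ∫ x in (M.cell c).carrier, (v - F.nodalProj c v) x ^ 2 ≤
      2 * (∫ x in (M.cell c).carrier, v x ^ 2) +
        2 * ∫ x in (M.cell c).carrier, F.nodalProj c v x ^ 2 := by
    rw [← integral_const_mul, ← integral_const_mul,
      ← integral_add (hv.integrableOn_sq.const_mul 2) (hq.integrableOn_sq.const_mul 2)]
    refine setIntegral_mono h1.integrableOn_sq
      ((hv.integrableOn_sq.const_mul 2).add (hq.integrableOn_sq.const_mul 2)) fun x => ?_
    simp only [Pi.sub_apply]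
    nlinarith [sq_nonneg (v x + F.nodalProj c v x)]
  simp only [localNodal, ← pow_two]
  nlinarith [mul_le_mul_of_nonneg_left h5 hs₁, mul_le_mul_of_nonneg_left h4 hs₁]

theorem setIntegral_sq_le_localNodal (hs₀ : 0 < s₀) (c : Fin M.numCells) {v : Plane → ℝ}
    (hv : IsLocalNodal (M.cell c) v) :
    ∫ x in (M.cell c).carrier, v x ^ 2 ≤ 2 * (1 + 1 / s₀) * F.localNodal c v v := by
  obtain ⟨h1, h2⟩ := isLocalNodal_sub_proj hF c hv
  have hq := (hF.proj_affine c v hv).isLocalNodal (M.cell c)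
  have h3 := hF.nodal_lower c _ h1 h2
  have h5 : ∫ x in (M.cell c).carrier, v x ^ 2 ≤
      2 * (∫ x in (M.cell c).carrier, (v - F.nodalProj c v) x ^ 2) +
        2 * ∫ x in (M.cell c).carrier, F.nodalProj c v x ^ 2 := by
    rw [← integral_const_mul, ← integral_const_mul,
      ← integral_add (h1.integrableOn_sq.const_mul 2) (hq.integrableOn_sq.const_mul 2)]
    refine setIntegral_mono hv.integrableOn_sq
      ((h1.integrableOn_sq.const_mul 2).add (hq.integrableOn_sq.const_mul 2)) fun x => ?_
    simp only [Pi.sub_apply]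
    nlinarith [sq_nonneg (v x - 2 * F.nodalProj c v x)]
  rw [mul_comm, ← le_div_iff₀ hs₀] at h3
  have h6 : 0 ≤ ∫ x in (M.cell c).carrier, F.nodalProj c v x ^ 2 :=
    integral_nonneg fun x => sq_nonneg _
  have h7 := hF.nodal_nonneg c (v - F.nodalProj c v)
  have h8 : 0 ≤ (∫ x in (M.cell c).carrier, F.nodalProj c v x ^ 2) / s₀ := by positivity
  simp only [localNodal, ← pow_two]
  have e : 2 * (1 + 1 / s₀) * ((∫ x in (M.cell c).carrier, F.nodalProj c v x ^ 2) +
      F.nodalStab c (v - F.nodalProj c v) (v - F.nodalProj c v)) =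
      2 * (∫ x in (M.cell c).carrier, F.nodalProj c v x ^ 2) +
      2 * ((∫ x in (M.cell c).carrier, F.nodalProj c v x ^ 2) / s₀) +
      2 * F.nodalStab c (v - F.nodalProj c v) (v - F.nodalProj c v) +
      2 * (F.nodalStab c (v - F.nodalProj c v) (v - F.nodalProj c v) / s₀) := by ring
  rw [e]
  linarith

section Star

variable {c : Fin M.numCells} {z : Plane} {r : ℝ} (hr : 0 < r)
  (hstar : ∀ y ∈ Metric.ball z r, StarConvex ℝ y (M.cell c).carrier)

include hr hstar

theorem setIntegral_norm_sq_le_localEdge (hs₀ : 0 < s₀) {w : Plane → Plane}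
    (hw : IsLocalEdge (M.cell c) w) :
    ∫ x in (M.cell c).carrier, ‖w x‖ ^ 2 ≤ 2 * (1 + 1 / s₀) * F.localEdge c w w := by
  have hq := isRT_rtProj (M.cell c) w
  have h1 : IsLocalEdge (M.cell c) (w - rtProj (M.cell c) w) :=
    hw.sub (IsLocalEdge.of_isRT hr hstar hq)
  have h3 := hF.edge_lower c _ h1 (rtProj_sub_rtProj hr hstar hw.memLp)
  rw [mul_comm, ← le_div_iff₀ hs₀] at h3
  simp only [Pi.sub_apply] at h3
  rw [setIntegral_norm_sq_eq_add hw.memLp]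
  have h6 : 0 ≤ ∫ x in (M.cell c).carrier, ‖rtProj (M.cell c) w x‖ ^ 2 :=
    integral_nonneg fun x => sq_nonneg _
  have h7 := hF.edge_nonneg c (w - rtProj (M.cell c) w)
  have h8 : 0 ≤ (∫ x in (M.cell c).carrier, ‖rtProj (M.cell c) w x‖ ^ 2) / s₀ := by positivity
  simp only [localEdge, real_inner_self_eq_norm_sq]
  set S := F.edgeStab c (w - rtProj (M.cell c) w) (w - rtProj (M.cell c) w)
  have h9 : 0 ≤ S / s₀ := by positivity
  have e : ∀ I : ℝ, 2 * (1 + 1 / s₀) * (I + S) = 2 * I + 2 * (I / s₀) + 2 * S + 2 * (S / s₀) :=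
    fun I => by ring
  rw [e]
  linarith

omit hF in
-- Linearity is restricted to L² fields, where `rtProj` is linear. The second argument is arbitrary,
-- so `rot` of a nodal function may stand there without being shown to be an edge field.
theorem localEdge_comb_left (a b : ℝ) {v w : Plane → Plane}
    (hv : MemLp v 2 (volume.restrict (M.cell c).carrier))
    (hw : MemLp w 2 (volume.restrict (M.cell c).carrier)) (u : Plane → Plane) :
    F.localEdge c (a • v + b • w) u = a * F.localEdge c v u + b * F.localEdge c w u := by
  have hpv := isRT_rtProj (M.cell c) v
  have hpw := isRT_rtProj (M.cell c) w
  have hpu := isRT_rtProj (M.cell c) u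
  have hproj : rtProj (M.cell c) (a • v + b • w) =
      a • rtProj (M.cell c) v + b • rtProj (M.cell c) w := by
    rw [rtProj_add hr hstar (hv.const_smul a) (hw.const_smul b), rtProj_smul hr hstar a hv,
      rtProj_smul hr hstar b hw]
  have hsub : a • v + b • w - (a • rtProj (M.cell c) v + b • rtProj (M.cell c) w) =
      a • (v - rtProj (M.cell c) v) + b • (w - rtProj (M.cell c) w) := by
    module
  simp only [localEdge, hproj, hsub, map_add, map_smul, LinearMap.add_apply, LinearMap.smul_apply,
    Pi.add_apply, Pi.smul_apply, inner_add_left, real_inner_smul_left, smul_eq_mul]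
  rw [integral_add ((integrableOn_inner_of_memLp hpv.memLp hpu.memLp).const_mul a)
    ((integrableOn_inner_of_memLp hpw.memLp hpu.memLp).const_mul b), integral_const_mul,
    integral_const_mul]
  ring

theorem localConvection_sq_le (hs₁ : 0 ≤ s₁) {ρ : ℝ} (hρ : 0 < ρ) (hrρ : r = ρ * (M.cell c).diam)
    {u : Plane → Plane} (hu : ContinuousOn u (closure Ω)) {B : Plane → Plane}
    (hB : IsLocalEdge (M.cell c) B) {v : Plane → ℝ} (hv : IsLocalNodal (M.cell c) v) :
    F.localNodal c (localInterp (M.cell c) fun x => cross (u x) (rtProj (M.cell c) B x)) v ^ 2 ≤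
      ((cP ^ 2 + s₁ * (2 + 2 * cP ^ 2)) ^ 2 * (2 / ρ ^ 2 + 11 / ρ ^ 4) * supNorm Ω u ^ 2 *
        ∫ x in (M.cell c).carrier, ‖B x‖ ^ 2) * ∫ x in (M.cell c).carrier, v x ^ 2 := by
  set f : Plane → ℝ := fun x => cross (u x) (rtProj (M.cell c) B x) with hf
  set w := localInterp (M.cell c) f
  set A := cP ^ 2 + s₁ * (2 + 2 * cP ^ 2)
  set κ := 2 / ρ ^ 2 + 11 / ρ ^ 4
  set U := supNorm Ω u
  have hA : 0 ≤ A := by positivity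
  have hκ : 0 ≤ κ := by positivity
  have hw : IsLocalNodal (M.cell c) w := isLocalNodal_localInterp _ _
  have hv0 : 0 ≤ ∫ x in (M.cell c).carrier, v x ^ 2 := integral_nonneg fun x => sq_nonneg _
  have hwB : ∫ x in (M.cell c).carrier, w x ^ 2 ≤
      κ * U ^ 2 * ∫ x in (M.cell c).carrier, ‖B x‖ ^ 2 := by
    obtain ⟨i, hi⟩ := exists_vertex_localInterp_sq_le (M.cell c) f
    have hmem := (M.cell c).vertex_mem_carrier i
    have hfi : f ((M.cell c).vertex i) ^ 2 ≤
        U ^ 2 * ‖rtProj (M.cell c) B ((M.cell c).vertex i)‖ ^ 2 := by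
      rw [← sq_abs, ← mul_pow]
      refine pow_le_pow_left₀ (abs_nonneg _) ((abs_cross_le _ _).trans ?_) 2
      gcongr
      exact M.norm_le_supNorm hu (M.carrier_subset_closure c hmem)
    have hinv := IsRT.volume_mul_norm_sq_le hr hstar hρ hrρ (isRT_rtProj (M.cell c) B) hmem
    have hpy := setIntegral_norm_sq_eq_add hB.memLp
    have hrest : 0 ≤ ∫ x in (M.cell c).carrier, ‖B x - rtProj (M.cell c) B x‖ ^ 2 :=
      integral_nonneg fun x => sq_nonneg _
    calc ∫ x in (M.cell c).carrier, w x ^ 2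
        ≤ volume.real (M.cell c).carrier * f ((M.cell c).vertex i) ^ 2 := hi
      _ ≤ volume.real (M.cell c).carrier *
          (U ^ 2 * ‖rtProj (M.cell c) B ((M.cell c).vertex i)‖ ^ 2) := by gcongr
      _ = U ^ 2 * (volume.real (M.cell c).carrier *
          ‖rtProj (M.cell c) B ((M.cell c).vertex i)‖ ^ 2) := by ring
      _ ≤ U ^ 2 * (κ * ∫ x in (M.cell c).carrier, ‖rtProj (M.cell c) B x‖ ^ 2) := by gcongr
      _ ≤ U ^ 2 * (κ * ∫ x in (M.cell c).carrier, ‖B x‖ ^ 2) := by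
          rw [hpy]
          exact mul_le_mul_of_nonneg_left (mul_le_mul_of_nonneg_left (by linarith) hκ)
            (sq_nonneg U)
      _ = _ := by ring
  calc F.localNodal c w v ^ 2 ≤ F.localNodal c w w * F.localNodal c v v :=
        localNodal_sq_le hF c hw hv
    _ ≤ (A * ∫ x in (M.cell c).carrier, w x ^ 2) * (A * ∫ x in (M.cell c).carrier, v x ^ 2) := by
        gcongr
        · exact localNodal_self_nonneg hF c v
        · exact localNodal_self_le hF hs₁ c hw
        · exact localNodal_self_le hF hs₁ c hv
    _ ≤ (A * (κ * U ^ 2 * ∫ x in (M.cell c).carrier, ‖B x‖ ^ 2)) *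
        (A * ∫ x in (M.cell c).carrier, v x ^ 2) := by gcongr
    _ = _ := by ring

end Star

end Local

end Forms

/-! ### Global forms: summation over the cells -/

namespace IsEdge

variable {Ω : Set Plane} {M : Mesh Ω}

/-- Makes B^{n+θ} an admissible test field in Faraday's law. -/
theorem comb (hΩ : interior (closure Ω) = Ω) (a b : ℝ) {v w : Plane → Plane} (hv : IsEdge M v)
    (hw : IsEdge M w) : IsEdge M (a • v + b • w) where
  loc c := ((hv.loc c).smul a).add ((hw.loc c).smul b)
  hdiv := by
    obtain ⟨d, hd, h⟩ := hv.hdiv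
    obtain ⟨d', hd', h'⟩ := hw.hdiv
    have hvm := M.memLp_of_cells hΩ fun c => (hv.loc c).memLp
    have hwm := M.memLp_of_cells hΩ fun c => (hw.loc c).memLp
    refine ⟨a • d + b • d', (hd.const_smul a).add (hd'.const_smul b), fun φ hφ hc hs => ?_⟩
    have hgm : MemLp (gradient φ) 2 (volume.restrict Ω) := by
      refine ((continuous_gradient hφ).memLp_of_hasCompactSupport ?_).restrict _
      exact (hc.fderiv ℝ).comp_left (map_zero _)
    have hφm : MemLp φ 2 (volume.restrict Ω) :=
      (hφ.continuous.memLp_of_hasCompactSupport hc).restrict _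
    have h1 : IntegrableOn (fun x => d x * φ x) Ω := hd.integrable_mul hφm
    have h2 : IntegrableOn (fun x => d' x * φ x) Ω := hd'.integrable_mul hφm
    simp only [Pi.add_apply, Pi.smul_apply, inner_add_left, real_inner_smul_left, smul_eq_mul,
      add_mul, mul_assoc]
    rw [integral_add ((integrableOn_inner_of_memLp hvm hgm).const_mul a)
      ((integrableOn_inner_of_memLp hwm hgm).const_mul b), integral_add (h1.const_mul a)
      (h2.const_mul b)]
    simp only [integral_const_mul, h φ hφ hc hs, h' φ hφ hc hs]
    ring

end IsEdge

namespace Forms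

variable {Ω : Set Plane} {M : Mesh Ω} {F : Forms M} {cP s₀ s₁ : ℝ}

section Global

variable (hF : F.IsAdmissible cP s₀ s₁)

include hF

theorem nodalSq_nonneg (v : Plane → ℝ) : 0 ≤ F.nodalSq v := by
  rw [nodalSq, nodal]
  exact Finset.sum_nonneg fun c _ => localNodal_self_nonneg hF c v

theorem edgeSq_nonneg (w : Plane → Plane) : 0 ≤ F.edgeSq w := by
  rw [edgeSq, edge]
  exact Finset.sum_nonneg fun c _ => localEdge_self_nonneg hF c w

theorem edge_comm (v w : Plane → Plane) : F.edge v w = F.edge w v :=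
  Finset.sum_congr rfl fun c _ => localEdge_comm hF c v w

theorem nodal_sq_le {v w : Plane → ℝ} (hv : IsNodal M v) (hw : IsNodal M w) :
    F.nodal v w ^ 2 ≤ F.nodalSq v * F.nodalSq w :=
  Finset.sum_sq_le_sum_mul_sum_of_sq_le_mul _ (fun c _ => localNodal_self_nonneg hF c v)
    (fun c _ => localNodal_self_nonneg hF c w) fun c _ => localNodal_sq_le hF c (hv c) (hw c)

theorem edge_sq_le (v w : Plane → Plane) : F.edge v w ^ 2 ≤ F.edgeSq v * F.edgeSq w :=
  Finset.sum_sq_le_sum_mul_sum_of_sq_le_mul _ (fun c _ => localEdge_self_nonneg hF c v)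
    (fun c _ => localEdge_self_nonneg hF c w) fun c _ => localEdge_sq_le hF c v w

theorem setIntegral_sq_le_nodalSq (hs₀ : 0 < s₀) (hΩ : interior (closure Ω) = Ω)
    {v : Plane → ℝ} (hv : IsNodal M v) :
    ∫ x in Ω, v x ^ 2 ≤ 2 * (1 + 1 / s₀) * F.nodalSq v := by
  rw [M.setIntegral_eq_sum hΩ fun c => (hv c).integrableOn_sq, nodalSq, nodal, Finset.mul_sum]
  exact Finset.sum_le_sum fun c _ => setIntegral_sq_le_localNodal hF hs₀ c (hv c)

section Regular

variable {ρ : ℝ} (hρ : 0 < ρ) (hM : M.IsRegular ρ)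

include hρ hM

theorem setIntegral_norm_sq_le_edgeSq (hs₀ : 0 < s₀) (hΩ : interior (closure Ω) = Ω)
    {w : Plane → Plane} (hw : IsEdge M w) :
    ∫ x in Ω, ‖w x‖ ^ 2 ≤ 2 * (1 + 1 / s₀) * F.edgeSq w := by
  rw [M.setIntegral_eq_sum hΩ fun c => (hw.loc c).memLp.integrable_norm_pow two_ne_zero, edgeSq,
    edge, Finset.mul_sum]
  refine Finset.sum_le_sum fun c _ => ?_
  obtain ⟨z, hz⟩ := (hM c).1
  exact setIntegral_norm_sq_le_localEdge hF (mul_pos hρ (M.cell c).diam_pos) hz hs₀ (hw.loc c)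

omit hF in
theorem edge_comb_left (a b : ℝ) {v w : Plane → Plane} (hv : IsEdge M v) (hw : IsEdge M w)
    (u : Plane → Plane) : F.edge (a • v + b • w) u = a * F.edge v u + b * F.edge w u := by
  rw [edge, edge, edge, Finset.mul_sum, Finset.mul_sum, ← Finset.sum_add_distrib]
  refine Finset.sum_congr rfl fun c _ => ?_
  obtain ⟨z, hz⟩ := (hM c).1
  exact localEdge_comb_left (mul_pos hρ (M.cell c).diam_pos) hz a b (hv.loc c).memLp
    (hw.loc c).memLp u

theorem edge_comb_comb (a b a' b' : ℝ) {v w : Plane → Plane} (hv : IsEdge M v)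
    (hw : IsEdge M w) :
    F.edge (a • v + b • w) (a' • v + b' • w) =
      a * a' * F.edgeSq v + (a * b' + b * a') * F.edge v w + b * b' * F.edgeSq w := by
  rw [edge_comb_left hρ hM a b hv hw, edge_comm hF v, edge_comm hF w,
    edge_comb_left hρ hM a' b' hv hw, edge_comb_left hρ hM a' b' hv hw, edge_comm hF w v, edgeSq,
    edgeSq]
  ring

theorem convection_sq_le (hs₁ : 0 ≤ s₁) (hΩ : interior (closure Ω) = Ω) {u : Plane → Plane}
    (hu : ContinuousOn u (closure Ω)) {B : Plane → Plane} (hB : IsEdge M B) {v : Plane → ℝ}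
    (hv : IsNodal M v) :
    F.convection u B v ^ 2 ≤
      ((cP ^ 2 + s₁ * (2 + 2 * cP ^ 2)) ^ 2 * (2 / ρ ^ 2 + 11 / ρ ^ 4) * supNorm Ω u ^ 2 *
        ∫ x in Ω, ‖B x‖ ^ 2) * ∫ x in Ω, v x ^ 2 := by
  rw [M.setIntegral_eq_sum hΩ fun c => (hv c).integrableOn_sq,
    M.setIntegral_eq_sum hΩ fun c => (hB.loc c).memLp.integrable_norm_pow two_ne_zero,
    Finset.mul_sum _ _ (_ * supNorm Ω u ^ 2), convection]
  refine Finset.sum_sq_le_sum_mul_sum_of_sq_le_mul _ (fun c _ => ?_) (fun c _ => ?_)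
    fun c _ => ?_
  · have : 0 ≤ ∫ x in (M.cell c).carrier, ‖B x‖ ^ 2 := integral_nonneg fun x => sq_nonneg _
    positivity
  · exact integral_nonneg fun x => sq_nonneg _
  · obtain ⟨z, hz⟩ := (hM c).1
    exact localConvection_sq_le hF (mul_pos hρ (M.cell c).diam_pos) hz hs₁ hρ rfl hu (hB.loc c)
      (hv c)

end Regular

end Global

end Forms

/-! ### Young's inequality, Gronwall's argument and the energy step -/

theorem neg_le_of_sq_le_mul {x a b : ℝ} (ha : 0 ≤ a) (hb : 0 ≤ b) (h : x ^ 2 ≤ a * b) {t : ℝ}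
    (ht : 0 < t) : -x ≤ t * a + b / (4 * t) := by
  refine (neg_le_abs x).trans (abs_le_of_sq_le_sq (h.trans ?_) (by positivity))
  have e : (t * a + b / (4 * t)) ^ 2 = a * b + (t * a - b / (4 * t)) ^ 2 := by
    field_simp
    ring
  rw [e]
  exact le_add_of_nonneg_right (sq_nonneg _)

/-- Discrete Gronwall estimate for a one-step energy inequality. -/
theorem theta_gronwall {θ dt K : ℝ} (hθ : 1 / 2 ≤ θ) (hθ1 : θ ≤ 1) (hdt : 0 < dt) (hK : 1 ≤ K)
    (hsmall : dt < 1 / (θ * K)) {N : ℕ} {b e h D : ℕ → ℝ} (hD : ∀ n, 0 ≤ D n)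
    (hstep : ∀ n < N, (θ - 1 / 2) * (D n / dt) + (b (n + 1) - b n) / (2 * dt) + 1 / 4 * e n ≤
      1 / 2 * h n + 1 / 2 * K * (θ * b (n + 1) + (1 - θ) * b n))
    {Q β γ : ℝ} (hQ : Q = dt * K) (hβ : β = (1 - Q * θ) / (1 + Q * (1 - θ)))
    (hγ : γ = 1 / (1 - Q * θ)) :
    0 < β ∧ 0 < γ ∧ ∀ n < N,
      β ^ (n + 1) * b (n + 1) +
          γ * dt / 2 * ∑ l ∈ Finset.range (n + 1), β ^ (n + 1 - l) * e (n - l) ≤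
        b 0 + γ * dt * ∑ l ∈ Finset.range (n + 1), β ^ (n + 1 - l) * h (n - l) := by
  have hQ0 : 0 < Q := by rw [hQ]; positivity
  have hQθ : 0 < 1 - Q * θ := by
    rw [lt_div_iff₀ (by positivity)] at hsmall
    rw [hQ]
    linarith
  have hR : 0 < 1 + Q * (1 - θ) := by nlinarith
  have hβ0 : 0 < β := by rw [hβ]; positivity
  have hγ0 : 0 < γ := by rw [hγ]; positivity
  refine ⟨hβ0, hγ0, ?_⟩
  -- The step inequality times 2 dt, divided by 1 + Q(1 - θ); β and γ are made for this, since γβ =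
  -- 1/(1 + Q(1 - θ)).
  have hone : ∀ n < N, β * b (n + 1) + γ * dt / 2 * (β * e n) ≤ b n + γ * dt * (β * h n) := by
    intro n hn
    have h0 : 0 ≤ (θ - 1 / 2) * (D n / dt) :=
      mul_nonneg (by linarith) (div_nonneg (hD n) hdt.le)
    have h1 := hstep n hn
    have h2 : (b (n + 1) - b n) / (2 * dt) ≤
        1 / 2 * h n + 1 / 2 * K * (θ * b (n + 1) + (1 - θ) * b n) - 1 / 4 * e n := by linarith
    rw [div_le_iff₀ (by positivity)] at h2
    have h3 : (1 - Q * θ) * b (n + 1) + dt / 2 * e n ≤ (1 + Q * (1 - θ)) * b n + dt * h n := by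
      rw [hQ]
      linarith
    have hγβ : γ * β = 1 / (1 + Q * (1 - θ)) := by
      rw [hγ, hβ]
      field_simp
    have e1 : β * b (n + 1) + γ * dt / 2 * (β * e n) =
        ((1 - Q * θ) * b (n + 1) + dt / 2 * e n) / (1 + Q * (1 - θ)) := by
      rw [show γ * dt / 2 * (β * e n) = (γ * β) * (dt / 2 * e n) by ring, hγβ, hβ]
      ring
    have e2 : b n + γ * dt * (β * h n) =
        ((1 + Q * (1 - θ)) * b n + dt * h n) / (1 + Q * (1 - θ)) := by
      rw [show γ * dt * (β * h n) = (γ * β) * (dt * h n) by ring, hγβ]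
      field_simp
    rw [e1, e2]
    gcongr
  have hsum : ∀ n < N, β ^ (n + 1) * b (n + 1) +
        γ * dt / 2 * ∑ j ∈ Finset.range (n + 1), β ^ (j + 1) * e j ≤
      b 0 + γ * dt * ∑ j ∈ Finset.range (n + 1), β ^ (j + 1) * h j := by
    intro n
    induction n with
    | zero =>
      intro hn
      simpa using hone 0 hn
    | succ n ih =>
      intro hn
      have h1 := ih (by omega)
      -- The weight β^{n+1} makes successive steps telescope.
      have h2 := mul_le_mul_of_nonneg_left (hone (n + 1) hn) (pow_pos hβ0 (n + 1)).le
      rw [Finset.sum_range_succ, Finset.sum_range_succ _ (n + 1)]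
      have e1 : β ^ (n + 1) * (β * b (n + 1 + 1) + γ * dt / 2 * (β * e (n + 1))) =
          β ^ (n + 1 + 1) * b (n + 1 + 1) + γ * dt / 2 * (β ^ (n + 1 + 1) * e (n + 1)) := by ring
      have e2 : β ^ (n + 1) * (b (n + 1) + γ * dt * (β * h (n + 1))) =
          β ^ (n + 1) * b (n + 1) + γ * dt * (β ^ (n + 1 + 1) * h (n + 1)) := by ring
      rw [e1, e2] at h2
      rw [mul_add, mul_add]
      linarith
  have hrefl : ∀ (f : ℕ → ℝ) (n : ℕ), ∑ l ∈ Finset.range (n + 1), β ^ (n + 1 - l) * f (n - l) =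
      ∑ j ∈ Finset.range (n + 1), β ^ (j + 1) * f j := by
    intro f n
    rw [← Finset.sum_range_reflect (fun j => β ^ (j + 1) * f j)]
    refine Finset.sum_congr rfl fun l hl => ?_
    have hl' : l ≤ n := Nat.lt_succ_iff.1 (Finset.mem_range.1 hl)
    rw [show n + 1 - l = n - l + 1 by omega, show n + 1 - 1 - l = n - l by omega]
  intro n hn
  rw [hrefl, hrefl]
  exact hsum n hn

/-- Testing the scheme with `B^{n+θ}` and `E^{n+θ}`: both energy inequalities, with different
weights in Young's inequality. -/
theorem IsSolution.energy_step {Ω : Set Plane} {M : Mesh Ω} {F : Forms M} {cP s₀ s₁ ρ : ℝ}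
    (hρ : 0 < ρ) (hs₀ : 0 < s₀) (hΩ : interior (closure Ω) = Ω) (hM : M.IsRegular ρ)
    (hF : F.IsAdmissible cP s₀ s₁) {u : Plane → Plane} {C₁ U : ℝ}
    (hconv : ∀ (B : Plane → Plane) (v : Plane → ℝ), IsEdge M B → IsNodal M v →
      F.convection u B v ^ 2 ≤ (C₁ ^ 2 * U ^ 2 * ∫ x in Ω, ‖B x‖ ^ 2) * ∫ x in Ω, v x ^ 2)
    {θ dt : ℝ} (hθ0 : 0 ≤ θ) (hθ1 : θ ≤ 1) (hdt : 0 < dt) {N : ℕ} {E₀ : ℕ → Plane → ℝ}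
    {B : ℕ → Plane → Plane} {E : ℕ → Plane → ℝ} (hsol : IsSolution F u θ dt N E₀ B E)
    {n : ℕ} (hn : n < N) {t : ℝ} (ht : 0 < t) :
    (θ - 1 / 2) * (F.edgeSq (B (n + 1) - B n) / dt)
        + (F.edgeSq (B (n + 1)) - F.edgeSq (B n)) / (2 * dt) + F.nodalSq (E n) ≤
      t * F.nodalSq (interp M (E₀ n)) + F.nodalSq (E n) / (4 * t)
        + 1 / 2 * F.edgeSq (rot (interp M (E₀ n))) + 1 / 4 * F.nodalSq (E n)
        + (1 / 2 + (C₁ * (2 * (1 + 1 / s₀))) ^ 2 * U ^ 2) *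
          (θ * F.edgeSq (B (n + 1)) + (1 - θ) * F.edgeSq (B n)) := by
  have hB1 := hsol.mem_edge (n + 1) hn
  have hB0 := hsol.mem_edge n hn.le
  have hBθ : IsEdge M (thetaAvg θ B n) := hB1.comb hΩ θ (1 - θ) hB0
  have hE := hsol.mem_nodal n hn
  have hI : IsNodal M (interp M (E₀ n)) := isNodal_interp M (E₀ n)
  have hfar := hsol.faraday n hn _ hBθ
  have hamp := hsol.ampereOhm n hn _ hE
  set b := F.edgeSq (thetaAvg θ B n) with hb
  set X := F.edgeSq (B (n + 1)) with hX
  set Y := F.edge (B (n + 1)) (B n)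
  set Z := F.edgeSq (B n) with hZ
  set L := 2 * (1 + 1 / s₀)
  have hL : 0 ≤ L := by positivity
  have hD : F.edgeSq (B (n + 1) - B n) = X - 2 * Y + Z := by
    rw [Forms.edgeSq, show B (n + 1) - B n = (1 : ℝ) • B (n + 1) + (-1 : ℝ) • B n by module,
      Forms.edge_comb_comb hF hρ hM _ _ _ _ hB1 hB0]
    ring
  -- Convexity of the squared norm with its exact defect, which has a sign because θ ∈ [0, 1].
  have hbeq : b = θ * X + (1 - θ) * Z - θ * (1 - θ) * F.edgeSq (B (n + 1) - B n) := by
    rw [hD, hb, Forms.edgeSq, thetaAvg, Forms.edge_comb_comb hF hρ hM _ _ _ _ hB1 hB0]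
    ring
  have hble : b ≤ θ * X + (1 - θ) * Z := by
    rw [hbeq]
    have : 0 ≤ θ * (1 - θ) * F.edgeSq (B (n + 1) - B n) :=
      mul_nonneg (mul_nonneg hθ0 (by linarith)) (Forms.edgeSq_nonneg hF _)
    linarith
  have hS : F.edge (dt⁻¹ • (B (n + 1) - B n)) (thetaAvg θ B n) =
      (θ - 1 / 2) * (F.edgeSq (B (n + 1) - B n) / dt) + (X - Z) / (2 * dt) := by
    rw [hD, thetaAvg,
      show dt⁻¹ • (B (n + 1) - B n) = dt⁻¹ • B (n + 1) + (-dt⁻¹) • B n by module,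
      Forms.edge_comb_comb hF hρ hM _ _ _ _ hB1 hB0, ← hX, ← hZ]
    field_simp
    ring
  rw [hS] at hfar
  -- After this swap the coupling terms in `hfar` and `hamp` are opposite and cancel in the final
  -- sum.
  rw [Forms.edge_comm hF (thetaAvg θ B n)] at hamp
  have hb0 : 0 ≤ b := Forms.edgeSq_nonneg hF _
  have hN0 : 0 ≤ F.nodalSq (E n) := Forms.nodalSq_nonneg hF _
  have h1 := neg_le_of_sq_le_mul (Forms.edgeSq_nonneg hF _) hb0
    (Forms.edge_sq_le hF (rot (interp M (E₀ n))) (thetaAvg θ B n)) (t := 1 / 2) (by norm_num)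
  have h2 := neg_le_of_sq_le_mul (Forms.nodalSq_nonneg hF _) hN0
    (Forms.nodal_sq_le hF hI hE.1) ht
  -- Replacing each of the two squared L² norms by a discrete one costs a factor L, which gives (C₁
  -- L)².
  have h3 : F.convection u (thetaAvg θ B n) (E n) ^ 2 ≤
      ((C₁ * L) ^ 2 * U ^ 2 * b) * F.nodalSq (E n) := by
    have hi : 0 ≤ ∫ x in Ω, (E n) x ^ 2 := integral_nonneg fun x => sq_nonneg _
    calc _ ≤ (C₁ ^ 2 * U ^ 2 * ∫ x in Ω, ‖thetaAvg θ B n x‖ ^ 2) * ∫ x in Ω, (E n) x ^ 2 :=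
          hconv _ _ hBθ hE.1
      _ ≤ (C₁ ^ 2 * U ^ 2 * (L * b)) * (L * F.nodalSq (E n)) := by
          refine mul_le_mul (mul_le_mul_of_nonneg_left
            (Forms.setIntegral_norm_sq_le_edgeSq hF hρ hM hs₀ hΩ hBθ) (by positivity))
            (Forms.setIntegral_sq_le_nodalSq hF hs₀ hΩ hE.1) hi (by positivity)
      _ = _ := by ring
  have h4 := neg_le_of_sq_le_mul (by positivity) hN0 h3 (t := 1) one_pos
  have h5 := mul_le_mul_of_nonneg_left hble
    (show (0 : ℝ) ≤ 1 / 2 + (C₁ * L) ^ 2 * U ^ 2 by positivity)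
  have hNN : F.nodal (E n) (E n) = F.nodalSq (E n) := rfl
  rw [hNN] at hamp
  linarith

end VEM

end

/-! ### Choice of the constant and assembly -/

theorem mainTheorem2 (ρ cP s₀ s₁ : ℝ) (hρ : 0 < ρ) (hcP : 0 < cP) (hs₀ : 0 < s₀)
    (hs₁ : s₀ ≤ s₁) :
    ∃ C : ℝ, 0 < C ∧
      ∀ (Ω : Set VEM.Plane), interior (closure Ω) = Ω →
      ∀ (M : VEM.Mesh Ω), M.IsRegular ρ →
      ∀ (F : VEM.Forms M), F.IsAdmissible cP s₀ s₁ →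
      ∀ (u : VEM.Plane → VEM.Plane), ContinuousOn u (closure Ω) →
        (∀ (B : VEM.Plane → VEM.Plane) (v : VEM.Plane → ℝ), VEM.IsEdge M B → VEM.IsNodal M v →
          |F.convection u B v| ≤
            C * VEM.supNorm Ω u * √(∫ x in Ω, ‖B x‖ ^ 2) * √(∫ x in Ω, v x ^ 2)) ∧
        ∀ (θ dt : ℝ), 0 ≤ θ → θ ≤ 1 → 0 < dt →
        ∀ (N : ℕ) (E₀ : ℕ → VEM.Plane → ℝ) (B : ℕ → VEM.Plane → VEM.Plane)
          (E : ℕ → VEM.Plane → ℝ), VEM.IsSolution F u θ dt N E₀ B E →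
          (∀ n < N,
            (θ - 1 / 2) * (F.edgeSq (B (n + 1) - B n) / dt)
                + (F.edgeSq (B (n + 1)) - F.edgeSq (B n)) / (2 * dt)
                + 1 / 2 * F.nodalSq (E n) ≤
              F.hrotSq (VEM.interp M (E₀ n))
                + 1 / 2 * (1 + 4 * C * VEM.supNorm Ω u ^ 2)
                  * (θ * F.edgeSq (B (n + 1)) + (1 - θ) * F.edgeSq (B n))) ∧
          (1 / 2 ≤ θ → dt < 1 / (θ * (1 + 4 * C * VEM.supNorm Ω u ^ 2)) →
            ∀ Q β γ : ℝ, Q = dt * (1 + 4 * C * VEM.supNorm Ω u ^ 2) →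
              β = (1 - Q * θ) / (1 + Q * (1 - θ)) → γ = 1 / (1 - Q * θ) →
              0 < β ∧ 0 < γ ∧
              ∀ n < N,
                β ^ (n + 1) * F.edgeSq (B (n + 1))
                    + γ * dt / 2 *
                      ∑ l ∈ Finset.range (n + 1), β ^ (n + 1 - l) * F.nodalSq (E (n - l)) ≤
                  F.edgeSq (B 0)
                    + γ * dt *
                      ∑ l ∈ Finset.range (n + 1),
                        β ^ (n + 1 - l) * F.hrotSq (VEM.interp M (E₀ (n - l)))) := by
  set A := cP ^ 2 + s₁ * (2 + 2 * cP ^ 2)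
  set κ := 2 / ρ ^ 2 + 11 / ρ ^ 4
  set L := 2 * (1 + 1 / s₀)
  have hs₁0 : 0 ≤ s₁ := hs₀.le.trans hs₁
  have hA0 : 0 ≤ A := by positivity
  have hκ0 : 0 ≤ κ := by positivity
  set C₁ := A * √κ with hC₁
  have hC₁0 : 0 ≤ C₁ := by positivity
  have hC₁sq : C₁ ^ 2 = A ^ 2 * κ := by rw [hC₁, mul_pow, Real.sq_sqrt hκ0]
  -- One constant serves two purposes: C₁ for the convection bound, which is linear in C, and (C₁
  -- L)² for the energy estimate, where Young squares the bound while the claim contains C only to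
  -- the first power. The 1 secures positivity.
  refine ⟨C₁ + (C₁ * L) ^ 2 + 1, by positivity, ?_⟩
  intro Ω hΩ M hM F hF u hu
  set C := C₁ + (C₁ * L) ^ 2 + 1 with hC
  set U := VEM.supNorm Ω u
  have hU : 0 ≤ U := VEM.supNorm_nonneg Ω u
  have hconv : ∀ (B : VEM.Plane → VEM.Plane) (v : VEM.Plane → ℝ), VEM.IsEdge M B →
      VEM.IsNodal M v → F.convection u B v ^ 2 ≤
        (C₁ ^ 2 * U ^ 2 * ∫ x in Ω, ‖B x‖ ^ 2) * ∫ x in Ω, v x ^ 2 := by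
    intro B v hB hv
    rw [hC₁sq]
    exact VEM.Forms.convection_sq_le hF hρ hM hs₁0 hΩ hu hB hv
  refine ⟨fun B v hB hv => ?_, ?_⟩
  · have hB0 : 0 ≤ ∫ x in Ω, ‖B x‖ ^ 2 := MeasureTheory.integral_nonneg fun x => sq_nonneg _
    have hv0 : 0 ≤ ∫ x in Ω, v x ^ 2 := MeasureTheory.integral_nonneg fun x => sq_nonneg _
    have h1 : |F.convection u B v| ≤ C₁ * U * √(∫ x in Ω, ‖B x‖ ^ 2) * √(∫ x in Ω, v x ^ 2) := by
      refine abs_le_of_sq_le_sq ((hconv B v hB hv).trans_eq ?_) (by positivity)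
      have e : ∀ c x y : ℝ, (c * U * x * y) ^ 2 = (c ^ 2 * U ^ 2 * x ^ 2) * y ^ 2 := fun c x y => by
        ring
      rw [e, Real.sq_sqrt hB0, Real.sq_sqrt hv0]
    refine h1.trans ?_
    gcongr
    rw [hC]
    nlinarith [sq_nonneg (C₁ * L)]
  intro θ dt hθ0 hθ1 hdt N E₀ B E hsol
  have hb : ∀ n, 0 ≤ F.edgeSq (B n) := fun n => VEM.Forms.edgeSq_nonneg hF _
  have hcoef : ∀ n, (1 / 2 + (C₁ * L) ^ 2 * U ^ 2) *
      (θ * F.edgeSq (B (n + 1)) + (1 - θ) * F.edgeSq (B n)) ≤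
      1 / 2 * (1 + 4 * C * U ^ 2) *
        (θ * F.edgeSq (B (n + 1)) + (1 - θ) * F.edgeSq (B n)) := by
    intro n
    refine mul_le_mul_of_nonneg_right ?_ (add_nonneg (mul_nonneg hθ0 (hb _))
      (mul_nonneg (by linarith) (hb _)))
    have : (C₁ * L) ^ 2 * U ^ 2 ≤ C * U ^ 2 := by
      gcongr
      rw [hC]
      linarith
    nlinarith [sq_nonneg (C₁ * L * U), this]
  have hstep : ∀ t : ℝ, 0 < t → ∀ n < N, _ := fun t ht n hn =>
    hsol.energy_step hρ hs₀ hΩ hM hF hconv hθ0 hθ1 hdt hn ht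
  refine ⟨fun n hn => ?_, ?_⟩
  -- With weight 1, 1/4 + 1/4 of |||E|||² is absorbed and one half remains.
  · have h1 := hstep 1 one_pos n hn
    have h2 := hcoef n
    have h3 := VEM.Forms.edgeSq_nonneg hF (VEM.rot (VEM.interp M (E₀ n)))
    rw [VEM.Forms.hrotSq]
    linarith
  · intro hθ hsmall Q β γ hQ hβ hγ
    have hK : 1 ≤ 1 + 4 * C * U ^ 2 := by
      have : 0 ≤ 4 * C * U ^ 2 := by positivity
      linarith
    refine VEM.theta_gronwall hθ hθ1 hdt hK hsmall (b := fun n => F.edgeSq (B n))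
      (e := fun n => F.nodalSq (E n)) (h := fun n => F.hrotSq (VEM.interp M (E₀ n)))
      (D := fun n => F.edgeSq (B (n + 1) - B n)) (fun n => VEM.Forms.edgeSq_nonneg hF _) ?_
      hQ hβ hγ
    intro n hn
    -- With weight 1/2, 1/2 + 1/4 of |||E|||² is absorbed; a quarter remains, and both data terms
    -- carry the factor 1/2.
    have h1 := hstep (1 / 2) (by norm_num) n hn
    have h2 := hcoef n
    simp only [VEM.Forms.hrotSq]
    linarith
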